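/- Let $p\ge 1$ be an integer and let $r(z)\in\mathbb{C}(z)$ be a rational function with $r(z)=O(z^{-2})$ as $z\to\infty$, none of whose poles is an integer. Let $T$ be the (finite) set of poles of $r$ in $\mathbb{C}$. Let $\psi=\Gamma'/\Gamma$ be the digamma function, $\psi^{(j)}$ its $j$-th derivative, and put $$g(z):=\frac{\pi\,\psi^{(p-1)}(-z)}{(p-1)!\,\sin(\pi z)}\,r(z),$$ where for $p=1$ the function $\psi(-z)$ is to be replaced by $\psi(-z)+\gamma$ ($\gamma$ the Euler--Mascheroni constant). Let $H_n^{(p)}:=\sum_{k=1}^n k^{-p}$ (so $H_0^{(p)}=0$), let $\zeta$ be the Riemann zeta function with the convention that $\zeta(1)$ is read as $0$, and let $\bar\zeta(s):=\sum_{n\ge1}(-1)^{n-1}n^{-s}$ for $s\geq 1$, with $\bar\zeta(0):=1/2$. Then all the series below converge absolutely, and $$\sum_{n=0}^\infty\Big((-1)^p\zeta(p)+H_n^{(p)}\Big)(-1)^n r(n)+(-1)^p\sum_{n=1}^\infty\Big(\zeta(p)-H_{n-1}^{(p)}\Big)(-1)^n r(-n)$$ $$\qquad+2\sum_{k=0}^{\lfloor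 p/2\rfloor}\frac{\bar\zeta(2k)}{(p-2k)!}\sum_{n=0}^\infty(-1)^n r^{(p-2k)}(n)+\sum_{\beta\in T}\operatorname{Res}(g(z),\beta)=0,$$ where $r^{(j)}$ denotes the $j$-th derivative of $r$ and $\operatorname{Res}(g(z),\beta)$ the residue of $g$ at $z=\beta$. -/

import Mathlib

namespace ParamEuler

/-- The generalized harmonic number `H_n^{(p)} = ∑_{k=1}^n 1 / k^p` (so `H_0^{(p)} = 0`). -/
noncomputable def harmonicNumber (p n : ℕ) : ℂ :=
  ∑ k ∈ Finset.Icc 1 n, 1 / (k : ℂ) ^ p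

/-- The Riemann zeta value `ζ(p)`, with the convention `ζ(1) := 0`. -/
noncomputable def zetaValue (p : ℕ) : ℂ :=
  if p = 1 then 0 else riemannZeta (p : ℂ)

/-- The alternating zeta value at the even integer `2 * k`, that is
`∑_{n ≥ 1} (-1)^(n-1) / n^(2k)` for `k ≥ 1` (the summation index is shifted by one),
with the convention that the value at `0` is `1 / 2`. -/
noncomputable def altZetaEven (k : ℕ) : ℂ :=
  if k = 0 then 1 / 2 else ∑' n : ℕ, (-1 : ℂ) ^ n / ((n : ℂ) + 1) ^ (2 * k)

/-- The polygamma function `ψ^{(p-1)}`, the derivative of order `p - 1` of the digamma function,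
where for `p = 1` the digamma function `ψ` is replaced by `ψ + γ`. -/
noncomputable def polygammaNormalized (p : ℕ) (s : ℂ) : ℂ :=
  if p = 1 then Complex.digamma s + (Real.eulerMascheroniConstant : ℂ)
  else iteratedDeriv (p - 1) Complex.digamma s

/-- The value `r(z)` of a rational function at a complex number (meaningful off the poles). -/
noncomputable def ratValue (r : RatFunc ℂ) (z : ℂ) : ℂ :=
  r.eval (RingHom.id ℂ) z

/-- The finite set of poles of a rational function in `ℂ`: the zeros of the denominator of its
reduced fraction. -/
noncomputable def poles (r : RatFunc ℂ) : Finset ℂ :=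
  r.denom.roots.toFinset

/-- The function `g(z) = π ψ^{(p-1)}(-z) / ((p-1)! sin (π z)) * r(z)`. -/
noncomputable def kernelMul (p : ℕ) (r : RatFunc ℂ) (z : ℂ) : ℂ :=
  (Real.pi : ℂ) * polygammaNormalized p (-z) /
    (((p - 1).factorial : ℂ) * Complex.sin ((Real.pi : ℂ) * z)) * ratValue r z

/-- The residue of `f` at an isolated singularity `c`: the integral `(2πi)⁻¹ ∮ f(z) dz` over the
circle of centre `c` and radius `ρ`, for `ρ → 0+` (it does not depend on `ρ` once `ρ` is small). -/
noncomputable def residue (f : ℂ → ℂ) (c : ℂ) : ℂ :=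
  Filter.limUnder (nhdsWithin (0 : ℝ) (Set.Ioi 0))
    (fun ρ : ℝ => (2 * (Real.pi : ℂ) * Complex.I)⁻¹ * ∮ z in C(c, ρ), f z)

end ParamEuler

/-! The identity says that the residues of `kernelMul p r` over all its poles add up to zero. On the
circles of radius N + 1/2 the polygamma factor is O(√N) (`exists_norm_polygammaFactor_le`), π /
sin(πz) is bounded (`half_le_norm_sin`) and r is O(N⁻²). As the length is O(N), the contour
integrals are O(N^(-1/2)). The residue theorem, proved here for a disc by peeling off principal
parts (`circleIntegral_eq_sum_residue`), then turns them into partial sums of residues.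

At a negative integer -(n+1) only 1/sin is singular. The residue is the value (-1)^p (ζ(p) - H_n) of
the polygamma factor times (-1)^(n+1) r(-(n+1)).

At a natural number n the recurrence of ψ makes the polygamma factor (z-n)^(-p) + B(z), with B
analytic and B(n) = (-1)^p ζ(p) + H_n (`exists_polygammaFactor_eq`), while π / sin(πz) is (-1)^n ∑ 2
ζ̄(2k) (z-n)^(2k-1) (`eventually_pi_div_sin`). B meets a simple pole and gives the harmonic term;
(z-n)^(-p) meets the terms 2k ≤ p and picks out the Taylor coefficients r^(p-2k)(n)/(p-2k)!
(`hasResidue_kernelMul_natCast`).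

All of this rests on the partial fractions of ψ + γ (`digamma_add_eulerMascheroni`) and of the
cotangent. The series converge since their coefficients are O(√n) and r with its derivatives is
O(n⁻²). -/

namespace ParamEuler

open Filter Topology

/-! ### Residues by small circles, and the residue theorem for a disc. -/

/-- `f` has residue `R` at `a`: the normalized integral of `f` along all small circles around `a`
is `R`. -/
def HasResidue (f : ℂ → ℂ) (a R : ℂ) : Prop :=
  ∀ᶠ ρ : ℝ in 𝓝[>] 0, CircleIntegrable f a ρ ∧
    (2 * (Real.pi : ℂ) * Complex.I)⁻¹ * (∮ z in C(a, ρ), f z) = R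

theorem HasResidue.residue_eq {f : ℂ → ℂ} {a R : ℂ} (h : HasResidue f a R) :
    residue f a = R := by
  apply Tendsto.limUnder_eq
  exact tendsto_const_nhds.congr' (h.mono fun ρ hρ => hρ.2.symm)

theorem eventually_sphere_of_eventually_nhdsNE {p : ℂ → Prop} {a : ℂ}
    (h : ∀ᶠ z in 𝓝[≠] a, p z) : ∀ᶠ ρ : ℝ in 𝓝[>] 0, ∀ z ∈ Metric.sphere a ρ, p z := by
  rw [eventually_nhdsWithin_iff, Metric.eventually_nhds_iff] at h
  obtain ⟨ε, hε, h⟩ := h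
  filter_upwards [Ioo_mem_nhdsGT hε] with ρ hρ z hz
  rw [Metric.mem_sphere] at hz
  refine h (by rw [hz]; exact hρ.2) ?_
  rintro rfl
  rw [dist_self] at hz
  exact hρ.1.ne hz

theorem HasResidue.congr {f g : ℂ → ℂ} {a R : ℂ} (hf : HasResidue f a R)
    (h : ∀ᶠ z in 𝓝[≠] a, f z = g z) : HasResidue g a R := by
  filter_upwards [hf, eventually_sphere_of_eventually_nhdsNE h, self_mem_nhdsWithin]
    with ρ h1 h2 (h3 : 0 < ρ)
  refine ⟨?_, ?_⟩
  · refine h1.1.congr_codiscreteWithin ?_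
    rw [abs_of_pos h3]
    filter_upwards [self_mem_codiscreteWithin _] with z hz using h2 z hz
  · rw [← circleIntegral.integral_congr h3.le h2, h1.2]

/-- Additivity is why `HasResidue` carries integrability: a non-integrable function would have
integral 0 by default. -/
theorem HasResidue.add {f g : ℂ → ℂ} {a R S : ℂ} (hf : HasResidue f a R)
    (hg : HasResidue g a S) : HasResidue (fun z => f z + g z) a (R + S) := by
  filter_upwards [hf, hg] with ρ h1 h2
  refine ⟨h1.1.add h2.1, ?_⟩
  rw [circleIntegral.integral_add h1.1 h2.1, mul_add, h1.2, h2.2]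

theorem HasResidue.const_mul {f : ℂ → ℂ} {a R : ℂ} (c : ℂ) (hf : HasResidue f a R) :
    HasResidue (fun z => c * f z) a (c * R) := by
  filter_upwards [hf] with ρ h1
  refine ⟨h1.1.const_smul (a := c), ?_⟩
  rw [circleIntegral.integral_const_mul, ← h1.2]
  ring

theorem HasResidue.sum {ι : Type*} {f : ι → ℂ → ℂ} {a : ℂ} {R : ι → ℂ} (s : Finset ι)
    (h : ∀ i ∈ s, HasResidue (f i) a (R i)) :
    HasResidue (fun z => ∑ i ∈ s, f i z) a (∑ i ∈ s, R i) := by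
  classical
  induction s using Finset.induction_on with
  | empty =>
    refine Eventually.of_forall fun ρ => ?_
    simp only [Finset.sum_empty]
    exact ⟨continuousOn_const.circleIntegrable', by simp [circleIntegral]⟩
  | insert i s hi ih =>
    simp only [Finset.sum_insert hi]
    exact (h i (Finset.mem_insert_self i s)).add
      (ih fun j hj => h j (Finset.mem_insert_of_mem hj))

theorem eventually_analyticOnNhd_closedBall {h : ℂ → ℂ} {a : ℂ} (ha : AnalyticAt ℂ h a) :
    ∀ᶠ ρ : ℝ in 𝓝[>] 0, 0 < ρ ∧ ∀ z ∈ Metric.closedBall a ρ, AnalyticAt ℂ h z := by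
  obtain ⟨ε, hε, h⟩ := Metric.eventually_nhds_iff.1 ha.eventually_analyticAt
  filter_upwards [Ioo_mem_nhdsGT hε] with ρ hρ
  exact ⟨hρ.1, fun z hz => h (lt_of_le_of_lt hz hρ.2)⟩

theorem diffContOnCl_ball_of_analyticAt {h : ℂ → ℂ} {a : ℂ} {ρ : ℝ}
    (hh : ∀ z ∈ Metric.closedBall a ρ, AnalyticAt ℂ h z) :
    DiffContOnCl ℂ h (Metric.ball a ρ) :=
  DifferentiableOn.diffContOnCl fun z hz =>
    (hh z (Metric.closure_ball_subset_closedBall hz)).differentiableAt.differentiableWithinAt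

/-- The residue of `G z / (z - a) ^ (m + 1)` is the `m`-th Taylor coefficient of `G`. -/
theorem hasResidue_mul_inv_pow {G : ℂ → ℂ} {a : ℂ} (hG : AnalyticAt ℂ G a) (m : ℕ) :
    HasResidue (fun z => G z * ((z - a) ^ (m + 1))⁻¹) a
      (1 / (m.factorial : ℂ) * iteratedDeriv m G a) := by
  filter_upwards [eventually_analyticOnNhd_closedBall hG] with ρ ⟨h0, hρ⟩
  refine ⟨?_, ?_⟩
  · refine ContinuousOn.circleIntegrable h0.le fun z hz => ?_
    refine ContinuousAt.continuousWithinAt (ContinuousAt.mul ?_ (ContinuousAt.inv₀ (by fun_prop) ?_))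
    · exact (hρ z (Metric.sphere_subset_closedBall hz)).continuousAt
    · refine pow_ne_zero _ (sub_ne_zero.2 ?_)
      rintro rfl
      simp at hz
      exact h0.ne hz
  · have := (diffContOnCl_ball_of_analyticAt hρ).circleIntegral_one_div_sub_center_pow_smul h0 m
    have h2 : (∮ z in C(a, ρ), G z * ((z - a) ^ (m + 1))⁻¹)
        = ∮ z in C(a, ρ), (1 / (z - a) ^ (m + 1)) • G z := by
      congr 1
      ext z
      simp [mul_comm]
    rw [h2, this, smul_eq_mul]
    have hpi : (Real.pi : ℂ) ≠ 0 := by exact_mod_cast Real.pi_ne_zero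
    have hf : (m.factorial : ℂ) ≠ 0 := by exact_mod_cast m.factorial_ne_zero
    field_simp

theorem hasResidue_zero_of_analyticAt {h : ℂ → ℂ} {a : ℂ} (ha : AnalyticAt ℂ h a) :
    HasResidue h a 0 := by
  have h1 : AnalyticAt ℂ (fun z => (z - a) * h z) a := by fun_prop
  have := hasResidue_mul_inv_pow h1 0
  simp only [iteratedDeriv_zero, sub_self, zero_mul, mul_zero, zero_add, pow_one] at this
  refine this.congr ?_
  filter_upwards [self_mem_nhdsWithin] with z hz
  have : z - a ≠ 0 := sub_ne_zero.2 hz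
  field_simp

open Polynomial in
/-- Splitting off the principal part of a meromorphic function. -/
theorem exists_principalPart {G : ℂ → ℂ} {a : ℂ} (n : ℕ) (hG : AnalyticAt ℂ G a) :
    ∃ (q : ℂ[X]) (h : ℂ → ℂ), AnalyticAt ℂ h a ∧
      ∀ z, z ≠ a → G z * ((z - a) ^ n)⁻¹ = q.eval (z - a)⁻¹ + h z := by
  induction n generalizing G with
  | zero => exact ⟨0, G, hG, by simp⟩
  | succ n ih =>
    -- G(z) = G(a) + (z - a) · `dslope G a z`: the constant gives the top-order polar term, and the
    -- slope lowers the order by one.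
    have hd : AnalyticAt ℂ (dslope G a) a := by
      obtain ⟨q, hq⟩ := hG
      exact hq.has_fpower_series_dslope_fslope.analyticAt
    obtain ⟨q, h, hh, hq⟩ := ih hd
    refine ⟨q + C (G a) * X ^ (n + 1), h, hh, fun z hz => ?_⟩
    have hza : z - a ≠ 0 := sub_ne_zero.2 hz
    have h1 := hq z hz
    rw [dslope_of_ne _ hz, slope_def_field] at h1
    simp only [eval_add, eval_mul, eval_C, eval_pow, eval_X]
    have h2 : G z * ((z - a) ^ (n + 1))⁻¹
        = (G z - G a) / (z - a) * ((z - a) ^ n)⁻¹ + G a * (z - a)⁻¹ ^ (n + 1) := by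
      rw [inv_pow]
      field_simp
      ring
    rw [h2, h1]
    ring

open Polynomial in
theorem MeromorphicAt.exists_principalPart {f : ℂ → ℂ} {a : ℂ} (hf : MeromorphicAt f a) :
    ∃ (q : ℂ[X]) (h : ℂ → ℂ), AnalyticAt ℂ h a ∧
      ∀ z, z ≠ a → f z = q.eval (z - a)⁻¹ + h z := by
  obtain ⟨n, hn⟩ := hf
  obtain ⟨q, h, hh, hq⟩ := ParamEuler.exists_principalPart n hn
  refine ⟨q, h, hh, fun z hz => ?_⟩
  have hza : z - a ≠ 0 := sub_ne_zero.2 hz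
  rw [← hq z hz, smul_eq_mul]
  field_simp

open Polynomial in
theorem analyticAt_eval_inv_sub (q : ℂ[X]) {a z : ℂ} (hz : z ≠ a) :
    AnalyticAt ℂ (fun z => q.eval (z - a)⁻¹) z := by
  have h1 : AnalyticAt ℂ (fun z : ℂ => (z - a)⁻¹) z :=
    AnalyticAt.inv (by fun_prop) (sub_ne_zero.2 hz)
  exact AnalyticAt.aeval_polynomial h1 q

open Polynomial in
-- Among the powers of (z - a)⁻¹ only the first has no primitive off a. The circle need not be
-- centred at a, as the residue theorem requires.
theorem circleIntegral_eval_inv_sub (q : ℂ[X]) {c a : ℂ} {R : ℝ} (ha : a ∈ Metric.ball c R) :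
    CircleIntegrable (fun z => q.eval (z - a)⁻¹) c R ∧
    (∮ z in C(c, R), q.eval (z - a)⁻¹) = 2 * Real.pi * Complex.I * q.coeff 1 := by
  have hR : 0 < R := dist_nonneg.trans_lt ha
  have hne : ∀ z ∈ Metric.sphere c R, z - a ≠ 0 := by
    intro z hz
    refine sub_ne_zero.2 ?_
    rintro rfl
    exact (ne_of_lt (Metric.mem_ball.1 ha)) (Metric.mem_sphere.1 hz)
  have hint : ∀ q : ℂ[X], CircleIntegrable (fun z => q.eval (z - a)⁻¹) c R := by
    intro q
    refine ContinuousOn.circleIntegrable hR.le fun z hz => ?_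
    exact (analyticAt_eval_inv_sub q (sub_ne_zero.1 (hne z hz))).continuousAt.continuousWithinAt
  refine ⟨hint q, ?_⟩
  induction q using Polynomial.induction_on' with
  | add p q hp hq =>
    simp only [eval_add, coeff_add]
    rw [circleIntegral.integral_add (hint p) (hint q), hp, hq]
    ring
  | monomial n b =>
    simp only [eval_monomial, coeff_monomial]
    rw [circleIntegral.integral_const_mul]
    by_cases hn : n = 1
    · subst hn
      simp only [pow_one, if_true]
      rw [circleIntegral.integral_sub_inv_of_mem_ball ha]
      ring
    · have := circleIntegral.integral_sub_zpow_of_ne (n := -(n : ℤ)) (by omega) c a R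
      simp only [zpow_neg, zpow_natCast] at this
      simp [hn, this]

open Polynomial in
theorem hasResidue_of_principalPart {f h : ℂ → ℂ} {a : ℂ} {q : ℂ[X]} (hh : AnalyticAt ℂ h a)
    (hf : ∀ᶠ z in 𝓝[≠] a, f z = q.eval (z - a)⁻¹ + h z) : HasResidue f a (q.coeff 1) := by
  have h1 : HasResidue (fun z => q.eval (z - a)⁻¹) a (q.coeff 1) := by
    filter_upwards [self_mem_nhdsWithin] with ρ (hρ : 0 < ρ)
    obtain ⟨h1, h2⟩ := circleIntegral_eval_inv_sub q (Metric.mem_ball_self (x := a) hρ)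
    refine ⟨h1, ?_⟩
    have hpi : (Real.pi : ℂ) ≠ 0 := by exact_mod_cast Real.pi_ne_zero
    rw [h2]
    field_simp
  have := h1.add (hasResidue_zero_of_analyticAt hh)
  rw [add_zero] at this
  exact this.congr (hf.mono fun z hz => hz.symm)

theorem MeromorphicAt.hasResidue {f : ℂ → ℂ} {a : ℂ} (hf : MeromorphicAt f a) :
    HasResidue f a (residue f a) := by
  obtain ⟨q, h, hh, hq⟩ := MeromorphicAt.exists_principalPart hf
  have := hasResidue_of_principalPart hh (eventually_nhdsWithin_of_forall hq)
  rwa [this.residue_eq]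

/-- **Residue theorem** for a disc. -/
theorem circleIntegral_eq_sum_residue {c : ℂ} {R : ℝ} (S : Finset ℂ) (f : ℂ → ℂ)
    (hR : 0 < R) (hS : ∀ s ∈ S, s ∈ Metric.ball c R ∧ MeromorphicAt f s)
    (hf : ∀ z ∈ Metric.closedBall c R, z ∉ S → AnalyticAt ℂ f z) :
    (∮ z in C(c, R), f z) = 2 * Real.pi * Complex.I * ∑ s ∈ S, residue f s := by
  classical
  induction S using Finset.induction_on generalizing f with
  | empty =>
    simp only [Finset.sum_empty, mul_zero]
    exact (diffContOnCl_ball_of_analyticAt fun z hz => hf z hz (by simp)).circleIntegral_eq_zero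
      hR.le
  | insert a S ha ih =>
    obtain ⟨hab, hm⟩ := hS a (Finset.mem_insert_self a S)
    -- Removing the principal part at a leaves h, analytic at a, with the same residues at the other
    -- points; the induction hypothesis applies to h.
    obtain ⟨q, h, hh, hq⟩ := MeromorphicAt.exists_principalPart hm
    have hres : residue f a = q.coeff 1 :=
      (hasResidue_of_principalPart hh (eventually_nhdsWithin_of_forall hq)).residue_eq
    have hheq : ∀ z, z ≠ a → h z = f z - q.eval (z - a)⁻¹ := fun z hz => by rw [hq z hz]; ring
    have hev : ∀ s, s ≠ a → h =ᶠ[𝓝 s] fun z => f z - q.eval (z - a)⁻¹ := by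
      intro s hs
      filter_upwards [isOpen_ne.mem_nhds hs] with z hz using hheq z hz
    have hne : ∀ s ∈ S, s ≠ a := fun s hs hsa => ha (hsa ▸ hs)
    have hmS : ∀ s ∈ S, MeromorphicAt f s := fun s hs => (hS s (Finset.mem_insert_of_mem hs)).2
    have ih' := ih h (fun s hs => ⟨(hS s (Finset.mem_insert_of_mem hs)).1,
      ((hmS s hs).sub (analyticAt_eval_inv_sub q (hne s hs)).meromorphicAt).congr
        ((hev s (hne s hs)).symm.filter_mono nhdsWithin_le_nhds)⟩) (by
      intro z hz hzS
      by_cases hza : z = a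
      · rwa [hza]
      · refine ((hf z hz ?_).sub (analyticAt_eval_inv_sub q hza)).congr (hev z hza).symm
        simp [hza, hzS])
    have hresS : ∀ s ∈ S, residue h s = residue f s := by
      intro s hs
      have h1 := (MeromorphicAt.hasResidue (hmS s hs)).add
        ((hasResidue_zero_of_analyticAt (analyticAt_eval_inv_sub q (hne s hs))).const_mul (-1))
      refine (h1.congr ?_).residue_eq.trans (by ring)
      refine ((hev s (hne s hs)).filter_mono nhdsWithin_le_nhds).mono fun z hz => ?_
      rw [hz]
      ring
    obtain ⟨hi1, hi2⟩ := circleIntegral_eval_inv_sub q hab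
    have hsa : ∀ z ∈ Metric.sphere c R, z ≠ a := by
      rintro z hz rfl
      exact (ne_of_lt (Metric.mem_ball.1 hab)) (Metric.mem_sphere.1 hz)
    have hih : CircleIntegrable h c R := by
      refine ContinuousOn.circleIntegrable hR.le fun z hz => ?_
      refine ContinuousAt.continuousWithinAt (AnalyticAt.continuousAt (𝕜 := ℂ) ?_)
      refine ((hf z (Metric.sphere_subset_closedBall hz) ?_).sub
        (analyticAt_eval_inv_sub q (hsa z hz))).congr (hev z (hsa z hz)).symm
      intro hmem
      rcases Finset.mem_insert.1 hmem with h1 | h1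
      · exact hsa z hz h1
      · exact (ne_of_lt (Metric.mem_ball.1 (hS z hmem).1)) (Metric.mem_sphere.1 hz)
    rw [circleIntegral.integral_congr hR.le (fun z hz => hq z (hsa z hz)),
      circleIntegral.integral_add hi1 hih, hi2, ih', Finset.sum_insert ha, hres,
      Finset.sum_congr rfl hresS]
    ring

/-! ### Partial fractions of the digamma function and its derivatives. -/

/-- The complement of the poles of the Gamma function. -/
def gammaDomain : Set ℂ := {s | ∀ m : ℕ, s ≠ -m}

/-- ‖s + k‖ never vanishes and grows like k, so (k+1)/‖s + k‖ is at most some K; moving s by less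
than 1/(2K) costs at most half of the bound. This supplies the locally uniform majorants for
termwise differentiation. -/
theorem exists_ball_le_norm_add_natCast {s : ℂ} (hs : s ∈ gammaDomain) :
    ∃ δ > 0, ∃ c > 0, ∀ w ∈ Metric.ball s δ, ∀ k : ℕ, c * ((k : ℝ) + 1) ≤ ‖w + k‖ := by
  have hpos : ∀ k : ℕ, 0 < ‖s + k‖ := fun k =>
    norm_pos_iff.2 fun h => hs k (eq_neg_of_add_eq_zero_left h)
  have htop : Tendsto (fun k : ℕ => ‖s + k‖) atTop atTop := by
    refine tendsto_atTop_mono (f := fun k : ℕ => (k : ℝ) - ‖s‖) (fun k => ?_)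
      (tendsto_atTop_add_const_right _ _ tendsto_natCast_atTop_atTop)
    have := norm_sub_le (s + k) s
    simp only [add_sub_cancel_left, Complex.norm_natCast] at this
    linarith
  obtain ⟨M, hM⟩ := (tendsto_inv_atTop_zero.comp htop).bddAbove_range
  have hM' : ∀ k : ℕ, ‖s + k‖⁻¹ ≤ M := fun k => hM ⟨k, rfl⟩
  have hM0 : 0 < M := (inv_pos.2 (hpos 0)).trans_le (hM' 0)
  set K := 1 + ‖1 - s‖ * M with hK
  have hK0 : 0 < K := by positivity
  have hle : ∀ k : ℕ, (k : ℝ) + 1 ≤ K * ‖s + k‖ := by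
    intro k
    have h1 : ‖((k : ℂ) + 1)‖ ≤ ‖s + k‖ + ‖1 - s‖ := by
      have := norm_add_le (s + k) (1 - s)
      rwa [show s + k + (1 - s) = (k : ℂ) + 1 by ring] at this
    have h2 : ‖((k : ℂ) + 1)‖ = (k : ℝ) + 1 := by exact_mod_cast Complex.norm_natCast (k + 1)
    have h3 : 1 ≤ M * ‖s + k‖ := by
      have := mul_le_mul_of_nonneg_right (hM' k) (hpos k).le
      rwa [inv_mul_cancel₀ (hpos k).ne'] at this
    have h4 := mul_le_mul_of_nonneg_left h3 (norm_nonneg (1 - s))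
    rw [hK]
    nlinarith
  refine ⟨(2 * K)⁻¹, by positivity, (2 * K)⁻¹, by positivity, fun w hw k => ?_⟩
  have h1 : ‖s + k‖ ≤ ‖w + k‖ + (2 * K)⁻¹ := by
    have h2 := norm_sub_le (w + k) (w - s)
    rw [show w + k - (w - s) = s + k by ring] at h2
    have h3 : ‖w - s‖ < (2 * K)⁻¹ := by rwa [← dist_eq_norm]
    linarith
  have h2 : (2 * K)⁻¹ * ((k : ℝ) + 1) ≤ 2⁻¹ * ‖s + k‖ := by
    rw [inv_mul_le_iff₀ (by positivity)]
    linarith [hle k]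
  have h3 : (2 * K)⁻¹ ≤ 2⁻¹ * ‖s + k‖ := by
    refine le_trans ?_ h2
    refine le_mul_of_one_le_right (by positivity) ?_
    have : (0 : ℝ) ≤ k := k.cast_nonneg
    linarith
  linarith

theorem mem_gammaDomain_of_le {w : ℂ} {c : ℝ} (hc : 0 < c)
    (h : ∀ k : ℕ, c * ((k : ℝ) + 1) ≤ ‖w + k‖) : w ∈ gammaDomain := by
  intro m hm
  have := h m
  rw [hm, neg_add_cancel, norm_zero] at this
  have : 0 < c * ((m : ℝ) + 1) := by positivity
  linarith

theorem isOpen_gammaDomain : IsOpen gammaDomain := by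
  rw [Metric.isOpen_iff]
  intro s hs
  obtain ⟨δ, hδ, c, hc, h⟩ := exists_ball_le_norm_add_natCast hs
  exact ⟨δ, hδ, fun w hw => mem_gammaDomain_of_le hc (h w hw)⟩

theorem isPreconnected_gammaDomain : IsPreconnected gammaDomain := by
  have h1 : gammaDomain = (Set.range fun m : ℕ => -(m : ℂ))ᶜ := by
    ext s
    simp [gammaDomain, eq_comm]
  rw [h1]
  refine ((Set.countable_range _).isPathConnected_compl_of_one_lt_rank ?_).isConnected.isPreconnected
  rw [Complex.rank_real_complex]
  norm_num

theorem add_natCast_ne_zero_of_mem_gammaDomain {s : ℂ} (hs : s ∈ gammaDomain) (k : ℕ) :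
    s + k ≠ 0 := fun h => hs k (eq_neg_of_add_eq_zero_left h)

theorem analyticAt_digamma {s : ℂ} (hs : s ∈ gammaDomain) : AnalyticAt ℂ Complex.digamma s := by
  have h1 : AnalyticAt ℂ Complex.Gamma s := by
    refine DifferentiableOn.analyticAt (s := gammaDomain) (fun w hw => ?_)
      (isOpen_gammaDomain.mem_nhds hs)
    exact (Complex.differentiableAt_Gamma w hw).differentiableWithinAt
  exact h1.deriv.div h1 (Complex.Gamma_ne_zero hs)

theorem summable_one_div_add_one_sq (M : ℝ) : Summable fun k : ℕ => M / ((k : ℝ) + 1) ^ 2 := by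
  have h := (summable_nat_add_iff 1).2 (Real.summable_one_div_nat_pow.2 (one_lt_two))
  simpa [div_eq_mul_inv] using h.mul_left M

/-- The series for `digamma s + γ`. -/
noncomputable def digammaSeries (s : ℂ) : ℂ := ∑' k : ℕ, (1 / ((k : ℂ) + 1) - 1 / (s + k))

theorem norm_digammaSeries_term_le {w : ℂ} {c : ℝ} (hc : 0 < c)
    (h : ∀ k : ℕ, c * ((k : ℝ) + 1) ≤ ‖w + k‖) (k : ℕ) :
    ‖1 / ((k : ℂ) + 1) - 1 / (w + k)‖ ≤ (‖w - 1‖ / c) / ((k : ℝ) + 1) ^ 2 := by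
  have hw := add_natCast_ne_zero_of_mem_gammaDomain (mem_gammaDomain_of_le hc h) k
  have hk : (k : ℂ) + 1 ≠ 0 := by exact_mod_cast k.succ_ne_zero
  have h2 : ‖((k : ℂ) + 1)‖ = (k : ℝ) + 1 := by exact_mod_cast Complex.norm_natCast (k + 1)
  rw [show 1 / ((k : ℂ) + 1) - 1 / (w + k) = (w - 1) / (((k : ℂ) + 1) * (w + k)) by
    field_simp; ring, norm_div, norm_mul, h2, div_div]
  refine div_le_div_of_nonneg_left (norm_nonneg _) (by positivity) ?_
  have := mul_le_mul_of_nonneg_left (h k) (by positivity : (0 : ℝ) ≤ (k : ℝ) + 1)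
  nlinarith

theorem norm_inv_pow_term_le {w : ℂ} {c : ℝ} (hc : 0 < c)
    (h : ∀ k : ℕ, c * ((k : ℝ) + 1) ≤ ‖w + k‖) (m k : ℕ) :
    ‖1 / (w + k) ^ (m + 2)‖ ≤ (1 / c ^ (m + 2)) / ((k : ℝ) + 1) ^ 2 := by
  rw [norm_div, norm_one, norm_pow, div_div]
  refine div_le_div_of_nonneg_left zero_le_one (by positivity) ?_
  calc c ^ (m + 2) * ((k : ℝ) + 1) ^ 2 ≤ c ^ (m + 2) * ((k : ℝ) + 1) ^ (m + 2) := by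
        gcongr
        · have : (0 : ℝ) ≤ k := k.cast_nonneg
          linarith
        · omega
    _ = (c * ((k : ℝ) + 1)) ^ (m + 2) := by rw [mul_pow]
    _ ≤ _ := by gcongr; exact h k

theorem hasDerivAt_one_div_add_pow {w : ℂ} (k m : ℕ) (hw : w + k ≠ 0) :
    HasDerivAt (fun w : ℂ => 1 / (w + k) ^ (m + 1)) (-((m : ℂ) + 1) * (1 / (w + k) ^ (m + 2))) w := by
  have h1 : HasDerivAt (fun w : ℂ => (w + k) ^ (m + 1)) (((m + 1 : ℕ) : ℂ) * (w + k) ^ m * 1) w :=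
    ((hasDerivAt_id w).add_const (k : ℂ)).pow (m + 1)
  have h2 := h1.inv (pow_ne_zero _ hw)
  simp only [one_div]
  refine HasDerivAt.congr_deriv h2 ?_
  push_cast
  field_simp
  ring

theorem summable_digammaSeries {s : ℂ} (hs : s ∈ gammaDomain) :
    Summable fun k : ℕ => 1 / ((k : ℂ) + 1) - 1 / (s + k) := by
  obtain ⟨δ, hδ, c, hc, h⟩ := exists_ball_le_norm_add_natCast hs
  exact .of_norm_bounded (summable_one_div_add_one_sq _)
    (norm_digammaSeries_term_le hc (h s (Metric.mem_ball_self hδ)))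

theorem hasDerivAt_digammaSeries {s : ℂ} (hs : s ∈ gammaDomain) :
    HasDerivAt digammaSeries (∑' k : ℕ, 1 / (s + k) ^ 2) s := by
  obtain ⟨δ, hδ, c, hc, h⟩ := exists_ball_le_norm_add_natCast hs
  have hd : ∀ k : ℕ, ∀ w ∈ Metric.ball s δ,
      HasDerivAt (fun w : ℂ => 1 / ((k : ℂ) + 1) - 1 / (w + k)) (1 / (w + k) ^ 2) w := by
    intro k w hw
    have hw' := add_natCast_ne_zero_of_mem_gammaDomain (mem_gammaDomain_of_le hc (h w hw)) k
    have := (hasDerivAt_one_div_add_pow k 0 hw').const_sub (1 / ((k : ℂ) + 1))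
    simpa using this
  have hb : ∀ (k : ℕ) (w : ℂ), w ∈ Metric.ball s δ →
      ‖1 / ((k : ℂ) + 1) - 1 / (w + k)‖ ≤ ((‖s - 1‖ + δ) / c) / ((k : ℝ) + 1) ^ 2 := by
    intro k w hw
    refine (norm_digammaSeries_term_le hc (h w hw) k).trans ?_
    gcongr
    have h1 := norm_add_le (w - s) (s - 1)
    rw [sub_add_sub_cancel] at h1
    have h2 : ‖w - s‖ < δ := by rwa [← dist_eq_norm]
    linarith
  have hD : ∀ k : ℕ, DifferentiableOn ℂ (fun w : ℂ => 1 / ((k : ℂ) + 1) - 1 / (w + k))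
      (Metric.ball s δ) := fun k w hw => (hd k w hw).differentiableAt.differentiableWithinAt
  have h1 := Complex.differentiableOn_tsum_of_summable_norm
    (summable_one_div_add_one_sq _) hD Metric.isOpen_ball hb
  have h2 := Complex.hasSum_deriv_of_summable_norm
    (summable_one_div_add_one_sq _) hD Metric.isOpen_ball hb (Metric.mem_ball_self hδ)
  have h3 := (h1.differentiableAt (Metric.ball_mem_nhds s hδ)).hasDerivAt
  rw [← h2.tsum_eq] at h3
  refine h3.congr_deriv (tsum_congr fun k => ?_)
  exact (hd k s (Metric.mem_ball_self hδ)).deriv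

theorem hasDerivAt_tsum_one_div_add_pow {s : ℂ} (hs : s ∈ gammaDomain) (m : ℕ) :
    HasDerivAt (fun w : ℂ => ∑' k : ℕ, 1 / (w + k) ^ (m + 2))
      (-((m : ℂ) + 2) * ∑' k : ℕ, 1 / (s + k) ^ (m + 3)) s := by
  obtain ⟨δ, hδ, c, hc, h⟩ := exists_ball_le_norm_add_natCast hs
  have hd : ∀ k : ℕ, ∀ w ∈ Metric.ball s δ,
      HasDerivAt (fun w : ℂ => 1 / (w + k) ^ (m + 2))
        (-((m : ℂ) + 2) * (1 / (w + k) ^ (m + 3))) w := by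
    intro k w hw
    have hw' := add_natCast_ne_zero_of_mem_gammaDomain (mem_gammaDomain_of_le hc (h w hw)) k
    convert hasDerivAt_one_div_add_pow k (m + 1) hw' using 2
    push_cast
    ring
  have hD : ∀ k : ℕ, DifferentiableOn ℂ (fun w : ℂ => 1 / (w + k) ^ (m + 2))
      (Metric.ball s δ) := fun k w hw => (hd k w hw).differentiableAt.differentiableWithinAt
  have hb : ∀ (k : ℕ) (w : ℂ), w ∈ Metric.ball s δ →
      ‖1 / (w + k) ^ (m + 2)‖ ≤ (1 / c ^ (m + 2)) / ((k : ℝ) + 1) ^ 2 := fun k w hw =>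
    norm_inv_pow_term_le hc (h w hw) m k
  have h1 := Complex.differentiableOn_tsum_of_summable_norm
    (summable_one_div_add_one_sq _) hD Metric.isOpen_ball hb
  have h2 := Complex.hasSum_deriv_of_summable_norm
    (summable_one_div_add_one_sq _) hD Metric.isOpen_ball hb (Metric.mem_ball_self hδ)
  have h3 := (h1.differentiableAt (Metric.ball_mem_nhds s hδ)).hasDerivAt
  rw [← h2.tsum_eq] at h3
  refine h3.congr_deriv ?_
  rw [← tsum_mul_left]
  exact tsum_congr fun k => (hd k s (Metric.mem_ball_self hδ)).deriv

theorem digamma_ofReal_eq_deriv_log_Gamma {x : ℝ} (hx : 0 < x) :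
    Complex.digamma (x : ℂ) = (deriv (Real.log ∘ Real.Gamma) x : ℝ) := by
  have hm : ∀ m : ℕ, x ≠ -m := fun m => by
    have : (0 : ℝ) ≤ m := m.cast_nonneg
    linarith
  have h0 := Real.Gamma_pos_of_pos hx
  have h1 : HasDerivAt Complex.Gamma (deriv Complex.Gamma x) x :=
    (Complex.differentiableAt_Gamma x fun m h => hm m (by exact_mod_cast h)).hasDerivAt
  have h2 : HasDerivAt (fun y : ℝ => Complex.Gamma y) (deriv Complex.Gamma x) x := h1.comp_ofReal
  have h3 : HasDerivAt (fun y : ℝ => Complex.Gamma y) ((deriv Real.Gamma x : ℝ) : ℂ) x := by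
    have := (Real.differentiableAt_Gamma hm).hasDerivAt.ofReal_comp
    simpa only [Complex.Gamma_ofReal] using this
  rw [Complex.digamma_def, logDeriv_apply, h2.unique h3, Complex.Gamma_ofReal, Function.comp_def,
    deriv.log (Real.differentiableAt_Gamma hm) h0.ne']
  push_cast
  rfl

/-- Log-convexity of Γ, as in the Bohr–Mollerup theorem: it singles out ψ among the solutions of its
recurrence. -/
theorem monotoneOn_deriv_log_Gamma :
    MonotoneOn (deriv (Real.log ∘ Real.Gamma)) (Set.Ioi 0) := by
  have hc : ConvexOn ℝ (Set.Ioi 0) (Real.log ∘ Real.Gamma) := Real.convexOn_log_Gamma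
  refine hc.monotoneOn_deriv fun x (hx : 0 < x) => ?_
  have hm : ∀ m : ℕ, x ≠ -m := fun m => by
    have : (0 : ℝ) ≤ m := m.cast_nonneg
    linarith
  exact (Real.differentiableAt_Gamma hm).log (Real.Gamma_pos_of_pos hx).ne'

theorem deriv_log_Gamma_add_natCast {x : ℝ} (hx : 0 < x) (n : ℕ) :
    deriv (Real.log ∘ Real.Gamma) (x + n)
      = deriv (Real.log ∘ Real.Gamma) x + ∑ k ∈ Finset.range n, 1 / (x + k) := by
  induction n with
  | zero => simp
  | succ n ih =>
    rw [Finset.sum_range_succ, ← add_assoc, ← ih]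
    have hxn : 0 < x + n := by positivity
    have h1 := Complex.digamma_apply_add_one ((x + n : ℝ) : ℂ) (fun m h => by
      have h2 : x + n = -m := by exact_mod_cast h
      have : (0 : ℝ) ≤ m := m.cast_nonneg
      linarith)
    rw [digamma_ofReal_eq_deriv_log_Gamma hxn, ← Complex.ofReal_one, ← Complex.ofReal_add,
      digamma_ofReal_eq_deriv_log_Gamma (by positivity), ← Complex.ofReal_inv,
      ← Complex.ofReal_add, Complex.ofReal_inj] at h1
    rw [Nat.cast_succ, ← add_assoc, h1, one_div]

theorem deriv_log_Gamma_one :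
    deriv (Real.log ∘ Real.Gamma) 1 = -Real.eulerMascheroniConstant := by
  have := digamma_ofReal_eq_deriv_log_Gamma one_pos
  rw [Complex.ofReal_one, Complex.digamma_one] at this
  exact_mod_cast this.symm

/-- By the recurrence at 1 and at x, the n-th partial sum differs from ψ(x) + γ by ψ(1+n) - ψ(x+n),
which monotonicity squeezes to 0. -/
theorem digamma_add_eulerMascheroni_of_mem_Ioc {x : ℝ} (hx : x ∈ Set.Ioc (0 : ℝ) 1) :
    Complex.digamma (x : ℂ) + Real.eulerMascheroniConstant = digammaSeries x := by
  set D := deriv (Real.log ∘ Real.Gamma) with hD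
  have hmem : (x : ℂ) ∈ gammaDomain := fun m h => by
    have h2 : x = -m := by exact_mod_cast h
    have : (0 : ℝ) ≤ m := m.cast_nonneg
    linarith [hx.1]
  have hs : Tendsto (fun n : ℕ => ∑ k ∈ Finset.range n, (1 / ((k : ℝ) + 1) - 1 / (x + k))) atTop
      (𝓝 (D x + Real.eulerMascheroniConstant)) := by
    have hone := deriv_log_Gamma_add_natCast one_pos
    have hxn := deriv_log_Gamma_add_natCast hx.1
    rw [deriv_log_Gamma_one] at hone
    rw [← hD] at hone hxn
    have key : ∀ n : ℕ, ∑ k ∈ Finset.range n, (1 / ((k : ℝ) + 1) - 1 / (x + k))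
        = D x + Real.eulerMascheroniConstant + (D (1 + n) - D (x + n)) := by
      intro n
      rw [hone, hxn, Finset.sum_sub_distrib]
      simp only [add_comm (1 : ℝ)]
      ring
    simp only [key]
    have h0 : Tendsto (fun n : ℕ => D (1 + n) - D (x + n)) atTop (𝓝 0) := by
      -- After the shift, x + (n+1) lies between 1 + n and 1 + (n+1), where ψ increases by exactly
      -- 1/(n+1).
      rw [← tendsto_add_atTop_iff_nat 1]
      refine squeeze_zero (g := fun n : ℕ => 1 / ((n : ℝ) + 1)) (fun n => ?_) (fun n => ?_)
        tendsto_one_div_add_atTop_nhds_zero_nat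
      · refine sub_nonneg.2 (monotoneOn_deriv_log_Gamma (Set.mem_Ioi.2 ?_) (Set.mem_Ioi.2 ?_) ?_)
        · have := hx.1
          positivity
        · positivity
        · linarith [hx.2]
      · have h1 : D (1 + n) ≤ D (x + (n + 1 : ℕ)) := by
          refine monotoneOn_deriv_log_Gamma (Set.mem_Ioi.2 (by positivity)) (Set.mem_Ioi.2 ?_) ?_
          · have := hx.1
            positivity
          · push_cast
            linarith [hx.1]
        have h2 : D (1 + (n + 1 : ℕ)) = D (1 + n) + 1 / ((n : ℝ) + 1) := by
          rw [hone, hone, Finset.sum_range_succ]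
          ring
        linarith
    simpa using h0.const_add (D x + Real.eulerMascheroniConstant)
  have hs' := (Complex.continuous_ofReal.tendsto _).comp hs
  have hsum := (summable_digammaSeries hmem).hasSum.tendsto_sum_nat
  rw [digamma_ofReal_eq_deriv_log_Gamma hx.1, ← hD]
  have := tendsto_nhds_unique (hs'.congr fun n => ?_) hsum
  · rw [digammaSeries, ← this]
    push_cast
    rfl
  · simp

/-- Identity theorem: both sides are analytic on the connected set `gammaDomain` and agree on (0,
1), which accumulates at 1/2. -/
theorem digamma_add_eulerMascheroni {s : ℂ} (hs : s ∈ gammaDomain) :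
    Complex.digamma s + Real.eulerMascheroniConstant = digammaSeries s := by
  have hA : AnalyticOnNhd ℂ (fun s => Complex.digamma s + Real.eulerMascheroniConstant)
      gammaDomain := fun s hs => (analyticAt_digamma hs).add analyticAt_const
  have hB : AnalyticOnNhd ℂ digammaSeries gammaDomain :=
    DifferentiableOn.analyticOnNhd
      (fun s hs => (hasDerivAt_digammaSeries hs).differentiableAt.differentiableWithinAt)
      isOpen_gammaDomain
  have h1 : (((1 / 2 : ℝ) : ℝ) : ℂ) ∈ gammaDomain := fun m h => by
    have h2 : (1 / 2 : ℝ) = -m := by exact_mod_cast h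
    have : (0 : ℝ) ≤ m := m.cast_nonneg
    linarith
  refine hA.eqOn_of_preconnected_of_frequently_eq hB isPreconnected_gammaDomain h1 ?_ hs
  have ht : Tendsto (fun x : ℝ => (x : ℂ)) (𝓝[≠] (1 / 2)) (𝓝[≠] ((1 / 2 : ℝ) : ℂ)) := by
    refine tendsto_nhdsWithin_of_tendsto_nhds_of_eventually_within _
      ((Complex.continuous_ofReal.tendsto _).mono_left nhdsWithin_le_nhds) ?_
    filter_upwards [self_mem_nhdsWithin] with x hx h
    exact hx (Complex.ofReal_injective h)
  refine ht.frequently (Eventually.frequently ?_)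
  filter_upwards [mem_nhdsWithin_of_mem_nhds (Ioo_mem_nhds (a := (0 : ℝ)) (b := 1)
    (by norm_num) (by norm_num))] with x hx
  exact digamma_add_eulerMascheroni_of_mem_Ioc ⟨hx.1, hx.2.le⟩

theorem iteratedDeriv_succ_digamma (m : ℕ) {s : ℂ} (hs : s ∈ gammaDomain) :
    iteratedDeriv (m + 1) Complex.digamma s
      = (-1) ^ m * ((m + 1).factorial : ℂ) * ∑' k : ℕ, 1 / (s + k) ^ (m + 2) := by
  induction m generalizing s with
  | zero =>
    have h1 : Complex.digamma =ᶠ[𝓝 s] fun w => digammaSeries w - Real.eulerMascheroniConstant := by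
      filter_upwards [isOpen_gammaDomain.mem_nhds hs] with w hw
      rw [← digamma_add_eulerMascheroni hw]
      ring
    rw [zero_add, iteratedDeriv_one, h1.deriv_eq, deriv_sub_const,
      (hasDerivAt_digammaSeries hs).deriv]
    simp
  | succ m ih =>
    have h1 : iteratedDeriv (m + 1) Complex.digamma =ᶠ[𝓝 s] fun w =>
        (-1) ^ m * ((m + 1).factorial : ℂ) * ∑' k : ℕ, 1 / (w + k) ^ (m + 2) := by
      filter_upwards [isOpen_gammaDomain.mem_nhds hs] with w hw using ih hw
    rw [iteratedDeriv_succ, h1.deriv_eq,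
      ((hasDerivAt_tsum_one_div_add_pow hs m).const_mul _).deriv, Nat.factorial_succ (m + 1)]
    push_cast
    ring

/-! ### The polygamma factor: recurrence, values at negative integers, polar parts. -/

/-- The polygamma factor `ψ^{(p-1)}(-z) / (p-1)!` of the kernel. -/
noncomputable def polygammaFactor (p : ℕ) (z : ℂ) : ℂ :=
  polygammaNormalized p (-z) / ((p - 1).factorial : ℂ)

theorem neg_mem_gammaDomain {z : ℂ} : -z ∈ gammaDomain ↔ ∀ m : ℕ, z ≠ m := by
  simp [gammaDomain]

theorem analyticAt_polygammaFactor (p : ℕ) {z : ℂ} (hz : -z ∈ gammaDomain) :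
    AnalyticAt ℂ (polygammaFactor p) z := by
  have h : AnalyticAt ℂ (polygammaNormalized p) (-z) := by
    unfold polygammaNormalized
    split_ifs with hp
    · exact (analyticAt_digamma hz).add analyticAt_const
    · rw [iteratedDeriv_eq_iterate]
      exact (analyticAt_digamma hz).iterated_deriv _
  have h2 : AnalyticAt ℂ (fun z => polygammaNormalized p (-z)) z :=
    h.fun_comp (f := fun z => -z) (by fun_prop)
  exact h2.div_const

theorem polygammaFactor_one {z : ℂ} (hz : -z ∈ gammaDomain) :
    polygammaFactor 1 z = ∑' k : ℕ, (1 / ((k : ℂ) + 1) + 1 / (z - k)) := by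
  simp only [polygammaFactor, polygammaNormalized, if_true, Nat.sub_self, Nat.factorial_zero,
    Nat.cast_one, div_one]
  rw [digamma_add_eulerMascheroni hz, digammaSeries]
  refine tsum_congr fun k => ?_
  rw [show -z + (k : ℂ) = -(z - k) by ring, div_neg, sub_neg_eq_add]

theorem polygammaFactor_add_two (m : ℕ) {z : ℂ} (hz : -z ∈ gammaDomain) :
    polygammaFactor (m + 2) z = ∑' k : ℕ, 1 / (z - k) ^ (m + 2) := by
  have h1 : m + 2 ≠ 1 := by omega
  have hf : ((m + 1).factorial : ℂ) ≠ 0 := by exact_mod_cast (m + 1).factorial_ne_zero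
  simp only [polygammaFactor, polygammaNormalized, if_neg h1]
  rw [show m + 2 - 1 = m + 1 by omega, iteratedDeriv_succ_digamma m hz, mul_right_comm,
    mul_div_cancel_right₀ _ hf, ← tsum_mul_left]
  refine tsum_congr fun k => ?_
  rw [show -z + (k : ℂ) = (-1) * (z - k) by ring, mul_pow, pow_add, mul_one_div]
  norm_num
  rw [← div_div, div_self (pow_ne_zero _ (by norm_num)), one_div]

theorem summable_polygammaFactor (m : ℕ) {z : ℂ} (hz : -z ∈ gammaDomain) :
    Summable fun k : ℕ => 1 / (z - k) ^ (m + 2) := by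
  obtain ⟨δ, hδ, c, hc, h⟩ := exists_ball_le_norm_add_natCast hz
  refine .of_norm_bounded (summable_one_div_add_one_sq (1 / c ^ (m + 2))) fun k => ?_
  refine le_trans (le_of_eq ?_)
    (norm_inv_pow_term_le hc (h (-z) (Metric.mem_ball_self hδ)) m k)
  rw [show -z + (k : ℂ) = -(z - k) by ring, norm_div, norm_div, norm_pow, norm_pow, norm_neg]

/-- For p = 1 this is ψ(s+1) = ψ(s) + 1/s; for p ≥ 2 it splits the first term off the series. -/
theorem polygammaFactor_eq_sub_one {p : ℕ} (hp : 1 ≤ p) {z : ℂ} (hz : -z ∈ gammaDomain) :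
    polygammaFactor p z = 1 / z ^ p + polygammaFactor p (z - 1) := by
  have hz' : -(z - 1) ∈ gammaDomain := by
    rw [neg_mem_gammaDomain] at hz ⊢
    intro m hm
    refine hz (m + 1) ?_
    push_cast
    rw [← hm]
    ring
  obtain rfl | ⟨m, rfl⟩ : p = 1 ∨ ∃ m, p = m + 2 := by
    rcases p with _ | _ | m
    · omega
    · exact Or.inl rfl
    · exact Or.inr ⟨m, rfl⟩
  · simp only [polygammaFactor, polygammaNormalized, if_true, Nat.sub_self, Nat.factorial_zero,
      Nat.cast_one, div_one, pow_one]
    rw [show -(z - 1) = -z + 1 by ring, Complex.digamma_apply_add_one _ hz, inv_neg]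
    ring
  · rw [polygammaFactor_add_two m hz, polygammaFactor_add_two m hz',
      (summable_polygammaFactor m hz).tsum_eq_zero_add]
    congr 1
    · simp
    · refine tsum_congr fun k => ?_
      push_cast
      ring

theorem neg_sub_natCast_mem_gammaDomain {z : ℂ} (hz : -z ∈ gammaDomain) (n : ℕ) :
    -(z - n) ∈ gammaDomain := by
  rw [neg_mem_gammaDomain] at hz ⊢
  intro m hm
  refine hz (m + n) ?_
  push_cast
  rw [← hm]
  ring

theorem polygammaFactor_eq_sum_add {p : ℕ} (hp : 1 ≤ p) {z : ℂ} (hz : -z ∈ gammaDomain) (n : ℕ) :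
    polygammaFactor p z = ∑ j ∈ Finset.range n, 1 / (z - j) ^ p + polygammaFactor p (z - n) := by
  induction n with
  | zero => simp
  | succ n ih =>
    rw [ih, polygammaFactor_eq_sub_one hp (neg_sub_natCast_mem_gammaDomain hz n),
      Finset.sum_range_succ, Nat.cast_succ, sub_sub z, add_assoc]

theorem neg_neg_one_mem_gammaDomain : -(-1 : ℂ) ∈ gammaDomain := by
  rw [neg_mem_gammaDomain]
  intro m h
  have h2 : ((m + 1 : ℕ) : ℂ) = 0 := by
    push_cast
    rw [← h]
    ring
  exact m.succ_ne_zero (by exact_mod_cast h2)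

/-- For p = 1 both sides vanish: ψ(1) = -γ is cancelled by the normalization, matching the
convention ζ(1) = 0. -/
theorem polygammaFactor_neg_one {p : ℕ} (hp : 1 ≤ p) :
    polygammaFactor p (-1) = (-1) ^ p * zetaValue p := by
  obtain rfl | ⟨m, rfl⟩ : p = 1 ∨ ∃ m, p = m + 2 := by
    rcases p with _ | _ | m
    · omega
    · exact Or.inl rfl
    · exact Or.inr ⟨m, rfl⟩
  · simp [polygammaFactor, polygammaNormalized, zetaValue, Complex.digamma_one]
  · have hs : Summable fun n : ℕ => 1 / (n : ℂ) ^ (m + 2) :=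
      .of_norm (by simp)
    rw [polygammaFactor_add_two m neg_neg_one_mem_gammaDomain, zetaValue, if_neg (by omega),
      zeta_nat_eq_tsum_of_gt_one (by omega), hs.tsum_eq_zero_add, mul_add, ← tsum_mul_left]
    simp only [Nat.cast_zero, zero_pow (Nat.succ_ne_zero (m + 1)), div_zero, mul_zero, zero_add]
    refine tsum_congr fun k => ?_
    rw [show (-1 : ℂ) - k = (-1) * ((k + 1 : ℕ) : ℂ) by push_cast; ring, mul_pow, ← div_div,
      one_div, ← inv_pow]
    norm_num
    ring

theorem harmonicNumber_eq_sum_range (p n : ℕ) :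
    harmonicNumber p n = ∑ j ∈ Finset.range n, 1 / ((j : ℂ) + 1) ^ p := by
  induction n with
  | zero => simp [harmonicNumber]
  | succ n ih =>
    rw [Finset.sum_range_succ, ← ih, harmonicNumber, Finset.sum_Icc_succ_top (by omega),
      harmonicNumber]
    push_cast
    rfl

theorem neg_one_pow_mul_harmonicNumber (p n : ℕ) :
    ∑ j ∈ Finset.range n, 1 / ((-1 : ℂ) - j) ^ p = (-1) ^ p * harmonicNumber p n := by
  rw [harmonicNumber_eq_sum_range, Finset.mul_sum]
  refine Finset.sum_congr rfl fun j _ => ?_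
  rw [show (-1 : ℂ) - j = (-1) * ((j : ℂ) + 1) by ring, mul_pow, ← div_div, one_div, ← inv_pow]
  norm_num
  ring

theorem polygammaFactor_neg {p : ℕ} (hp : 1 ≤ p) (n : ℕ) :
    polygammaFactor p (-((n : ℂ) + 1)) = (-1) ^ p * (zetaValue p - harmonicNumber p n) := by
  have h := polygammaFactor_eq_sum_add hp neg_neg_one_mem_gammaDomain n
  rw [polygammaFactor_neg_one hp, neg_one_pow_mul_harmonicNumber] at h
  rw [show -((n : ℂ) + 1) = -1 - n by ring, mul_sub, h]
  ring

theorem sum_one_div_sub_pow (p n : ℕ) :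
    ∑ j ∈ Finset.range n, 1 / ((n : ℂ) - j) ^ p = harmonicNumber p n := by
  rw [harmonicNumber_eq_sum_range, ← Finset.sum_range_reflect]
  refine Finset.sum_congr rfl fun j hj => ?_
  have hj' := Finset.mem_range.1 hj
  rw [show n - 1 - j = n - (j + 1) by omega, Nat.cast_sub (by omega)]
  push_cast
  ring

/-- The polar part of the polygamma factor at a natural number. -/
theorem exists_polygammaFactor_eq {p : ℕ} (hp : 1 ≤ p) (n : ℕ) :
    ∃ B : ℂ → ℂ, AnalyticAt ℂ B n ∧ B n = (-1) ^ p * zetaValue p + harmonicNumber p n ∧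
      ∀ᶠ z in 𝓝[≠] (n : ℂ), polygammaFactor p z = ((z - n) ^ p)⁻¹ + B z := by
  -- Applying the recurrence n + 1 times isolates the pole in the term j = n. The terms j < n give
  -- H_n at n, and the shifted factor is evaluated at -1.
  refine ⟨fun z => ∑ j ∈ Finset.range n, 1 / (z - j) ^ p + polygammaFactor p (z - (n + 1 : ℕ)),
    ?_, ?_, ?_⟩
  · refine AnalyticAt.fun_add (Finset.analyticAt_fun_sum _ fun j hj => ?_) ?_
    · refine analyticAt_const.fun_div (by fun_prop) (pow_ne_zero _ (sub_ne_zero.2 ?_))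
      have := Finset.mem_range.1 hj
      exact_mod_cast (by omega : n ≠ j)
    · refine AnalyticAt.fun_comp (f := fun z : ℂ => z - (n + 1 : ℕ)) (analyticAt_polygammaFactor p ?_)
        (by fun_prop)
      push_cast
      rw [show (n : ℂ) - (n + 1) = -1 by ring]
      exact neg_neg_one_mem_gammaDomain
  · have h1 : (n : ℂ) - (n + 1 : ℕ) = -1 := by
      push_cast
      ring
    simp only [h1, sum_one_div_sub_pow, polygammaFactor_neg_one hp]
    ring
  · have hev : ∀ᶠ z in 𝓝[≠] (n : ℂ), -z ∈ gammaDomain := by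
      rw [eventually_nhdsWithin_iff, Metric.eventually_nhds_iff]
      refine ⟨1, one_pos, fun z hz hzn => ?_⟩
      rw [neg_mem_gammaDomain]
      rintro m rfl
      rw [Complex.dist_eq, ← Int.cast_natCast, ← Int.cast_natCast n, ← Int.cast_sub,
        Complex.norm_intCast] at hz
      have h2 : |(m : ℤ) - n| < 1 := by exact_mod_cast hz
      rw [Int.abs_lt_one_iff] at h2
      exact hzn (by
        have : m = n := by omega
        rw [this]
        rfl)
    filter_upwards [hev] with z hz
    rw [polygammaFactor_eq_sum_add hp hz (n + 1), Finset.sum_range_succ, one_div ((z - n) ^ p)]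
    ring

/-! ### Growth of the polygamma factor on the circles of radius N + 1/2. -/

/-- The larger of a and b is at least R/2. Half a power of it yields R^(-1/2), and the other half
exceeds the square root of the smaller one; the product becomes two terms of exponent 3/2, each
summable. -/
theorem one_div_mul_le {a b R : ℝ} (ha : 0 < a) (hb : 0 < b) (hR : 0 < R) (h : R ≤ a + b) :
    1 / (a * b) ≤ 2 / √R * (1 / (a * √a) + 1 / (b * √b)) := by
  have key : ∀ {a b : ℝ}, 0 < a → 0 < b → R ≤ a + b → a ≤ b →
      1 / (a * b) ≤ 2 / √R * (1 / (a * √a)) := by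
    intro a b ha hb h hab
    have hR' : 0 < √R := Real.sqrt_pos.2 hR
    have ha' : 0 < √a := Real.sqrt_pos.2 ha
    have h1 : √R ≤ 2 * √b := by
      rw [Real.sqrt_le_left (by positivity), mul_pow, Real.sq_sqrt hb.le]
      linarith
    have h2 : √a ≤ √b := Real.sqrt_le_sqrt hab
    have h3 : b = √b * √b := (Real.mul_self_sqrt hb.le).symm
    rw [div_mul_div_comm, mul_one, div_le_div_iff₀ (by positivity) (by positivity), one_mul]
    calc √R * (a * √a) ≤ (2 * √b) * (a * √b) := by gcongr
      _ = 2 * (a * (√b * √b)) := by ring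
      _ = 2 * (a * b) := by rw [← h3]
  rcases le_total a b with hab | hab
  · refine (key ha hb h hab).trans ?_
    gcongr
    have : 0 ≤ 1 / (b * √b) := by positivity
    linarith
  · rw [mul_comm a b]
    refine (key hb ha (by linarith) hab).trans ?_
    gcongr
    have : 0 ≤ 1 / (a * √a) := by positivity
    linarith

theorem rpow_three_halves {x : ℝ} (hx : 0 < x) : x ^ (3 / 2 : ℝ) = x * √x := by
  rw [Real.sqrt_eq_rpow, ← Real.rpow_one_add' hx.le (by norm_num)]
  norm_num

theorem half_le_abs_sub_natCast (N k : ℕ) : 1 / 2 ≤ |(N : ℝ) + 1 / 2 - k| := by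
  rcases le_or_gt k N with h | h
  · have : (k : ℝ) ≤ N := by exact_mod_cast h
    refine le_trans ?_ (le_abs_self _)
    linarith
  · have : (N : ℝ) + 1 ≤ k := by exact_mod_cast h
    refine le_trans ?_ (neg_le_abs _)
    linarith

/-- The series `∑_k |R - k|^{-3/2}` is bounded uniformly in the half-integer `R`. -/
theorem exists_tsum_half_integer_le : ∃ T : ℝ, ∀ N : ℕ,
    Summable (fun k : ℕ => 1 / (|(N : ℝ) + 1 / 2 - k| * √|(N : ℝ) + 1 / 2 - k|)) ∧
    ∑' k : ℕ, 1 / (|(N : ℝ) + 1 / 2 - k| * √|(N : ℝ) + 1 / 2 - k|) ≤ T := by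
  have hs := (Real.summable_one_div_int_add_rpow (1 / 2) (3 / 2)).2 (by norm_num)
  refine ⟨∑' n : ℤ, 1 / |(n : ℝ) + 1 / 2| ^ (3 / 2 : ℝ), fun N => ?_⟩
  -- The numbers N + 1/2 - k are distinct half-integers, so the sum is part of a fixed sum over ℤ.
  have hi : Function.Injective (fun k : ℕ => (N : ℤ) - k) := fun a b h => by
    simp only at h
    omega
  have heq : (fun k : ℕ => 1 / (|(N : ℝ) + 1 / 2 - k| * √|(N : ℝ) + 1 / 2 - k|))
      = (fun n : ℤ => 1 / |(n : ℝ) + 1 / 2| ^ (3 / 2 : ℝ)) ∘ fun k : ℕ => (N : ℤ) - k := by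
    ext k
    have h1 := half_le_abs_sub_natCast N k
    rw [Function.comp_apply, ← rpow_three_halves (by linarith)]
    push_cast
    rw [sub_add_eq_add_sub]
  rw [heq]
  exact ⟨hs.comp_injective hi, tsum_comp_le_tsum_of_inj hs (fun n => by positivity) hi⟩

theorem neg_mem_gammaDomain_of_norm {N : ℕ} {z : ℂ} (hz : ‖z‖ = N + 1 / 2) :
    -z ∈ gammaDomain := by
  rw [neg_mem_gammaDomain]
  rintro m rfl
  have h1 := half_le_abs_sub_natCast N m
  rw [Complex.norm_natCast] at hz
  rw [← hz, sub_self, abs_zero] at h1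
  linarith

theorem abs_sub_natCast_le_norm {N : ℕ} {z : ℂ} (hz : ‖z‖ = N + 1 / 2) (k : ℕ) :
    |(N : ℝ) + 1 / 2 - k| ≤ ‖z - k‖ := by
  rw [← hz, ← Complex.norm_natCast k]
  exact abs_norm_sub_norm_le z k

/-- The k-th term is (z+1)/((k+1)(z-k)) with |z-k| ≥ |R-k| and (k+1) + |R-k| ≥ R, so
`one_div_mul_le` gives R · R^(-1/2). Any bound o(R) would suffice for the contour integral. -/
theorem exists_norm_polygammaFactor_one_le : ∃ C : ℝ, ∀ (N : ℕ) (z : ℂ), ‖z‖ = N + 1 / 2 →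
    ‖polygammaFactor 1 z‖ ≤ C * √((N : ℝ) + 1 / 2) := by
  obtain ⟨T, hT⟩ := exists_tsum_half_integer_le
  have hs : Summable fun k : ℕ => 1 / (((k : ℝ) + 1) * √((k : ℝ) + 1)) := by
    have h := (Real.summable_one_div_nat_add_rpow 1 (3 / 2)).2 (by norm_num)
    refine h.congr fun k => ?_
    have : (0 : ℝ) < (k : ℝ) + 1 := by positivity
    rw [abs_of_pos this, rpow_three_halves this]
  refine ⟨6 * (∑' k : ℕ, 1 / (((k : ℝ) + 1) * √((k : ℝ) + 1)) + T), fun N z hz => ?_⟩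
  set R := (N : ℝ) + 1 / 2 with hRdef
  have hR : 1 / 2 ≤ R := by
    have : (0 : ℝ) ≤ N := N.cast_nonneg
    linarith
  have hR0 : 0 < R := by linarith
  have hmem := neg_mem_gammaDomain_of_norm hz
  obtain ⟨hT1, hT2⟩ := hT N
  rw [polygammaFactor_one hmem]
  have hterm : ∀ k : ℕ, ‖1 / ((k : ℂ) + 1) + 1 / (z - k)‖ ≤ (R + 1) * (2 / √R) *
      (1 / (((k : ℝ) + 1) * √((k : ℝ) + 1)) + 1 / (|R - k| * √|R - k|)) := by
    intro k
    have hk : (k : ℂ) + 1 ≠ 0 := by exact_mod_cast k.succ_ne_zero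
    have h2 : ‖((k : ℂ) + 1)‖ = (k : ℝ) + 1 := by exact_mod_cast Complex.norm_natCast (k + 1)
    have hd := half_le_abs_sub_natCast N k
    have hd2 := abs_sub_natCast_le_norm hz k
    rw [← hRdef] at hd hd2
    have hzk : z - k ≠ 0 := norm_pos_iff.1 (by linarith)
    have hd0 : 0 < |R - k| := by linarith
    rw [show 1 / ((k : ℂ) + 1) + 1 / (z - k) = (z + 1) / (((k : ℂ) + 1) * (z - k)) by
      field_simp; ring, norm_div, norm_mul, h2]
    have h3 : ‖z + 1‖ ≤ R + 1 := by
      have := norm_add_le z 1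
      rwa [hz, norm_one] at this
    calc ‖z + 1‖ / (((k : ℝ) + 1) * ‖z - k‖) ≤ (R + 1) / (((k : ℝ) + 1) * |R - k|) := by gcongr
      _ = (R + 1) * (1 / (((k : ℝ) + 1) * |R - k|)) := by ring
      _ ≤ (R + 1) * (2 / √R * (1 / (((k : ℝ) + 1) * √((k : ℝ) + 1)) +
          1 / (|R - k| * √|R - k|))) := by
        gcongr
        refine one_div_mul_le (by positivity) hd0 hR0 ?_
        have := le_abs_self (R - k)
        linarith
      _ = _ := by ring
  have hsum := (hs.add hT1).mul_left ((R + 1) * (2 / √R))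
  refine (tsum_of_norm_bounded hsum.hasSum hterm).trans ?_
  rw [tsum_mul_left, hs.tsum_add hT1]
  have h0 : 0 ≤ ∑' k : ℕ, 1 / (((k : ℝ) + 1) * √((k : ℝ) + 1)) := tsum_nonneg fun k => by positivity
  have h0' : 0 ≤ ∑' k : ℕ, 1 / (|R - k| * √|R - k|) := tsum_nonneg fun k => by positivity
  have hc : (R + 1) * (2 / √R) ≤ 6 * √R := by
    have hR' : 0 < √R := Real.sqrt_pos.2 hR0
    rw [← mul_div_assoc, div_le_iff₀ hR', mul_assoc, Real.mul_self_sqrt hR0.le]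
    linarith
  calc _ ≤ 6 * √R * (∑' k : ℕ, 1 / (((k : ℝ) + 1) * √((k : ℝ) + 1)) + T) := by
        gcongr
    _ = _ := by ring

/-- The factor is in fact bounded here; √R only matches the case p = 1. Since d = |R-k| ≥ 1/2, the
powers of 2d increase with the exponent, so the 3/2-series dominates. -/
theorem exists_norm_polygammaFactor_add_two_le (m : ℕ) :
    ∃ C : ℝ, ∀ (N : ℕ) (z : ℂ), ‖z‖ = N + 1 / 2 →
    ‖polygammaFactor (m + 2) z‖ ≤ C * √((N : ℝ) + 1 / 2) := by
  obtain ⟨T, hT⟩ := exists_tsum_half_integer_le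
  refine ⟨2 ^ (m + 2) * T * 2, fun N z hz => ?_⟩
  set R := (N : ℝ) + 1 / 2 with hRdef
  have hR : 1 / 2 ≤ R := by
    have : (0 : ℝ) ≤ N := N.cast_nonneg
    linarith
  obtain ⟨hT1, hT2⟩ := hT N
  rw [polygammaFactor_add_two m (neg_mem_gammaDomain_of_norm hz)]
  have hterm : ∀ k : ℕ, ‖1 / (z - k) ^ (m + 2)‖ ≤ 2 ^ (m + 2) * (1 / (|R - k| * √|R - k|)) := by
    intro k
    have hd := half_le_abs_sub_natCast N k
    have hd2 := abs_sub_natCast_le_norm hz k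
    rw [← hRdef] at hd hd2
    set d := |R - k| with hddef
    have hd0 : 0 < d := by linarith
    rw [norm_div, norm_one, norm_pow, mul_one_div, div_le_div_iff₀ (pow_pos (by linarith) _)
      (by positivity), one_mul]
    have h1 : 1 ≤ 2 * d := by linarith
    have h2 : √d ≤ 2 * d := by
      rw [Real.sqrt_le_left (by positivity)]
      nlinarith
    calc d * √d ≤ (2 * d) * (2 * d) := by
          gcongr
          linarith
      _ = (2 * d) ^ 2 := by ring
      _ ≤ (2 * d) ^ (m + 2) := pow_le_pow_right₀ h1 (by omega)
      _ = 2 ^ (m + 2) * d ^ (m + 2) := mul_pow _ _ _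
      _ ≤ _ := by gcongr
  refine (tsum_of_norm_bounded (hT1.mul_left _).hasSum hterm).trans ?_
  rw [tsum_mul_left]
  have h0 : 0 ≤ ∑' k : ℕ, 1 / (|R - k| * √|R - k|) := tsum_nonneg fun k => by positivity
  have h1 : 1 ≤ 2 * √R := by
    have : √(1 / 4) ≤ √R := Real.sqrt_le_sqrt (by linarith)
    rw [show (1 / 4 : ℝ) = (1 / 2) ^ 2 by norm_num, Real.sqrt_sq (by norm_num)] at this
    linarith
  have hT0 : 0 ≤ T := h0.trans hT2
  calc _ ≤ 2 ^ (m + 2) * T := by gcongr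
    _ ≤ 2 ^ (m + 2) * T * (2 * √R) := le_mul_of_one_le_right (by positivity) h1
    _ = _ := by ring

theorem exists_norm_polygammaFactor_le {p : ℕ} (hp : 1 ≤ p) :
    ∃ C : ℝ, ∀ (N : ℕ) (z : ℂ), ‖z‖ = N + 1 / 2 →
    ‖polygammaFactor p z‖ ≤ C * √((N : ℝ) + 1 / 2) := by
  rcases p with _ | _ | m
  · omega
  · exact exists_norm_polygammaFactor_one_le
  · exact exists_norm_polygammaFactor_add_two_le m

/-! ### Laurent expansion of π / sin(πz) at the integers. -/

/-- The remainders in the expansion of `π z cot (π z)` at `0`. -/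
noncomputable def cotTail (K : ℕ) (z : ℂ) : ℂ :=
  ∑' n : ℕ, 1 / (((n : ℂ) + 1) ^ (2 * K) * (z ^ 2 - ((n : ℂ) + 1) ^ 2))

theorem le_norm_sq_sub_sq {z : ℂ} (hz : z ∈ Metric.ball (0 : ℂ) (1 / 2)) (n : ℕ) :
    1 / 2 * ((n : ℝ) + 1) ^ 2 ≤ ‖z ^ 2 - ((n : ℂ) + 1) ^ 2‖ := by
  have h1 : ‖z‖ < 1 / 2 := by simpa using hz
  have h2 : ‖((n : ℂ) + 1)‖ = (n : ℝ) + 1 := by exact_mod_cast Complex.norm_natCast (n + 1)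
  have h3 := norm_sub_norm_le (((n : ℂ) + 1) ^ 2) (z ^ 2)
  rw [norm_pow, norm_pow, h2, norm_sub_rev] at h3
  have h4 : (1 : ℝ) ≤ (n : ℝ) + 1 := by
    have : (0 : ℝ) ≤ n := n.cast_nonneg
    linarith
  have h5 := norm_nonneg z
  nlinarith

theorem norm_cotTail_term_le (K : ℕ) {z : ℂ} (hz : z ∈ Metric.ball (0 : ℂ) (1 / 2)) (n : ℕ) :
    ‖1 / (((n : ℂ) + 1) ^ (2 * K) * (z ^ 2 - ((n : ℂ) + 1) ^ 2))‖ ≤ 2 / ((n : ℝ) + 1) ^ 2 := by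
  have h2 : ‖((n : ℂ) + 1)‖ = (n : ℝ) + 1 := by exact_mod_cast Complex.norm_natCast (n + 1)
  have h3 : (1 : ℝ) ≤ ((n : ℝ) + 1) ^ (2 * K) := one_le_pow₀ (by
    have : (0 : ℝ) ≤ n := n.cast_nonneg
    linarith)
  have h4 := le_norm_sq_sub_sq hz n
  have h5 : 0 < ((n : ℝ) + 1) ^ 2 := by positivity
  rw [norm_div, norm_one, norm_mul, norm_pow, h2, div_le_div_iff₀ (by nlinarith) h5]
  nlinarith

theorem sq_sub_sq_ne_zero {z : ℂ} (hz : z ∈ Metric.ball (0 : ℂ) (1 / 2)) (n : ℕ) :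
    z ^ 2 - ((n : ℂ) + 1) ^ 2 ≠ 0 := by
  have h4 := le_norm_sq_sub_sq hz n
  have h5 : 0 < ((n : ℝ) + 1) ^ 2 := by positivity
  exact norm_pos_iff.1 (by linarith)

theorem summable_cotTail (K : ℕ) {z : ℂ} (hz : z ∈ Metric.ball (0 : ℂ) (1 / 2)) :
    Summable fun n : ℕ => 1 / (((n : ℂ) + 1) ^ (2 * K) * (z ^ 2 - ((n : ℂ) + 1) ^ 2)) :=
  .of_norm_bounded (summable_one_div_add_one_sq 2) (norm_cotTail_term_le K hz)

theorem differentiableOn_cotTail (K : ℕ) :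
    DifferentiableOn ℂ (cotTail K) (Metric.ball 0 (1 / 2)) := by
  refine Complex.differentiableOn_tsum_of_summable_norm (summable_one_div_add_one_sq 2)
    (fun n z hz => ?_) Metric.isOpen_ball fun n z hz => norm_cotTail_term_le K hz n
  refine DifferentiableAt.differentiableWithinAt ((differentiableAt_const _).fun_div (by fun_prop) ?_)
  have : (n : ℂ) + 1 ≠ 0 := by exact_mod_cast n.succ_ne_zero
  exact mul_ne_zero (pow_ne_zero _ this) (sq_sub_sq_ne_zero hz n)

theorem summable_one_div_add_one_pow {k : ℕ} (hk : k ≠ 0) :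
    Summable fun n : ℕ => 1 / ((n : ℂ) + 1) ^ (2 * k) := by
  refine .of_norm_bounded (summable_one_div_add_one_sq 1) fun n => ?_
  have h2 : ‖((n : ℂ) + 1)‖ = (n : ℝ) + 1 := by exact_mod_cast Complex.norm_natCast (n + 1)
  rw [norm_div, norm_one, norm_pow, h2]
  have h4 : (1 : ℝ) ≤ (n : ℝ) + 1 := by
    have : (0 : ℝ) ≤ n := n.cast_nonneg
    linarith
  gcongr
  omega

/-- One step of the geometric expansion of 1/(z² - m²), m = n + 1, in each term: 1/(z² - m²) = -1/m²
+ z²/(m²(z² - m²)). -/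
theorem cotTail_eq (K : ℕ) {z : ℂ} (hz : z ∈ Metric.ball (0 : ℂ) (1 / 2)) :
    cotTail K z = -∑' n : ℕ, 1 / ((n : ℂ) + 1) ^ (2 * (K + 1)) + z ^ 2 * cotTail (K + 1) z := by
  rw [cotTail, cotTail, ← tsum_neg, ← tsum_mul_left,
    ← (summable_one_div_add_one_pow K.succ_ne_zero).neg.tsum_add
      ((summable_cotTail (K + 1) hz).mul_left _)]
  refine tsum_congr fun n => ?_
  have h1 : (n : ℂ) + 1 ≠ 0 := by exact_mod_cast n.succ_ne_zero
  have h2 := sq_sub_sq_ne_zero hz n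
  have h3 : ((n : ℂ) + 1) ^ (2 * (K + 1)) = ((n : ℂ) + 1) ^ (2 * K) * ((n : ℂ) + 1) ^ 2 := by ring
  have h4 : ((n : ℂ) + 1) ^ (2 * K) ≠ 0 := pow_ne_zero _ h1
  rw [h3]
  field_simp
  ring

theorem mem_integerComplement_of_mem_ball {z : ℂ} (hz : z ∈ Metric.ball (0 : ℂ) (1 / 2))
    (h0 : z ≠ 0) : z ∈ Complex.integerComplement := by
  rw [Complex.mem_integerComplement_iff]
  rintro ⟨n, rfl⟩
  have h1 : ‖(n : ℂ)‖ < 1 := by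
    have : ‖(n : ℂ)‖ < 1 / 2 := by simpa using hz
    linarith
  rw [Complex.norm_intCast] at h1
  have h2 : |n| < 1 := by exact_mod_cast h1
  rw [Int.abs_lt_one_iff] at h2
  exact h0 (by simp [h2])

theorem mul_pi_mul_cot {z : ℂ} (hz : z ∈ Metric.ball (0 : ℂ) (1 / 2)) (h0 : z ≠ 0) :
    z * (Real.pi * Complex.cot (Real.pi * z)) = 1 + z ^ 2 * (2 * cotTail 0 z) := by
  have hc := mem_integerComplement_of_mem_ball hz h0
  have h1 := cot_series_rep' hc
  have h2 : ∑' n : ℕ, (1 / (z - (n + 1)) + 1 / (z + (n + 1))) = 2 * z * cotTail 0 z := by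
    rw [cotTail, ← tsum_mul_left]
    refine tsum_congr fun n => ?_
    have h3 := sq_sub_sq_ne_zero hz n
    rw [sq_sub_sq, mul_comm] at h3
    rw [one_div_add_one_div (left_ne_zero_of_mul h3) (right_ne_zero_of_mul h3)]
    ring
  rw [h2, sub_eq_iff_eq_add] at h1
  rw [h1]
  field_simp
  ring

/-- The remainders in the expansion of `π z / sin (π z)` at `0`. -/
noncomputable def cscTail (K : ℕ) (z : ℂ) : ℂ :=
  1 / 4 ^ K * cotTail K (z / 2) - 2 * cotTail K z

/-- The terms with negative sign are those of even base, whose sum is 4^(-k) ζ(2k); they are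
subtracted twice. -/
theorem altZetaEven_of_ne_zero {k : ℕ} (hk : k ≠ 0) :
    altZetaEven k = (1 - 2 / 4 ^ k) * ∑' n : ℕ, 1 / ((n : ℂ) + 1) ^ (2 * k) := by
  set f : ℕ → ℂ := fun n => 1 / ((n : ℂ) + 1) ^ (2 * k) with hf
  have hs : Summable f := summable_one_div_add_one_pow hk
  have he : Summable fun n => f (2 * n) := hs.comp_injective fun a b h => by grind
  have ho : Summable fun n => f (2 * n + 1) := hs.comp_injective fun a b h => by grind
  have h1 := tsum_even_add_odd he ho
  have h2 : ∑' n, f (2 * n + 1) = 1 / 4 ^ k * ∑' n, f n := by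
    rw [← tsum_mul_left]
    refine tsum_congr fun n => ?_
    simp only [hf]
    rw [div_mul_div_comm, one_mul, show (4 : ℂ) ^ k = 2 ^ (2 * k) by rw [pow_mul]; norm_num,
      ← mul_pow]
    push_cast
    ring
  have h3 : altZetaEven k = ∑' n, f (2 * n) + -∑' n, f (2 * n + 1) := by
    rw [altZetaEven, if_neg hk, ← tsum_neg]
    have e1 : ∀ n : ℕ, (-1 : ℂ) ^ (2 * n) / (((2 * n : ℕ) : ℂ) + 1) ^ (2 * k) = f (2 * n) := by
      intro n
      simp [hf]
    have e2 : ∀ n : ℕ, (-1 : ℂ) ^ (2 * n + 1) / (((2 * n + 1 : ℕ) : ℂ) + 1) ^ (2 * k)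
        = -f (2 * n + 1) := by
      intro n
      simp only [hf, pow_succ, pow_mul]
      ring
    rw [← tsum_even_add_odd (f := fun n : ℕ => (-1 : ℂ) ^ n / ((n : ℂ) + 1) ^ (2 * k))
      (he.congr fun n => (e1 n).symm) (ho.neg.congr fun n => (e2 n).symm)]
    simp only [e1, e2]
  rw [h3, ← sub_eq_add_neg, eq_sub_of_add_eq h1, h2]
  ring

theorem half_mem_ball {z : ℂ} (hz : z ∈ Metric.ball (0 : ℂ) (1 / 2)) :
    z / 2 ∈ Metric.ball (0 : ℂ) (1 / 2) := by
  simp only [Metric.mem_ball, dist_zero_right, norm_div, Complex.norm_ofNat] at hz ⊢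
  linarith [norm_nonneg z]

/-- Reflects csc x = cot(x/2) - cot x. Halving z contributes the powers of 4, and 2 - 4^(-K) = 2(1 -
2/4^(K+1)) turns ζ(2K+2) into its alternating version. -/
theorem cscTail_eq (K : ℕ) {z : ℂ} (hz : z ∈ Metric.ball (0 : ℂ) (1 / 2)) :
    cscTail K z = 2 * altZetaEven (K + 1) + z ^ 2 * cscTail (K + 1) z := by
  rw [altZetaEven_of_ne_zero K.succ_ne_zero, cscTail, cscTail, cotTail_eq K hz,
    cotTail_eq K (half_mem_ball hz), pow_succ (4 : ℂ)]
  have h4 : (4 : ℂ) ^ K ≠ 0 := pow_ne_zero _ (by norm_num)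
  field_simp
  ring

theorem analyticAt_cscTail (K : ℕ) : AnalyticAt ℂ (cscTail K) 0 := by
  have h0 : (0 : ℂ) ∈ Metric.ball (0 : ℂ) (1 / 2) := Metric.mem_ball_self (by norm_num)
  have h1 : AnalyticAt ℂ (cotTail K) 0 :=
    (differentiableOn_cotTail K).analyticAt (Metric.isOpen_ball.mem_nhds h0)
  have h2 : AnalyticAt ℂ (fun z => cotTail K (z / 2)) 0 :=
    AnalyticAt.fun_comp (f := fun z : ℂ => z / 2) (by simpa using h1) (by fun_prop)
  exact (analyticAt_const.mul h2).sub (analyticAt_const.mul h1)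

theorem one_div_sin_eq_cot_sub_cot {x : ℂ} (hx : Complex.sin x ≠ 0) :
    1 / Complex.sin x = Complex.cot (x / 2) - Complex.cot x := by
  have h1 : Complex.sin x = 2 * Complex.sin (x / 2) * Complex.cos (x / 2) := by
    rw [← Complex.sin_two_mul]
    ring_nf
  have h2 : Complex.cos x = 2 * Complex.cos (x / 2) ^ 2 - 1 := by
    rw [← Complex.cos_two_mul]
    ring_nf
  rw [h1] at hx
  have hc := right_ne_zero_of_mul hx
  have hs := right_ne_zero_of_mul (left_ne_zero_of_mul hx)
  rw [Complex.cot, Complex.cot, h1, h2]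
  field_simp
  ring

/-- The expansion of `π z / sin (π z)` at `0`. -/
theorem mul_pi_div_sin (K : ℕ) {z : ℂ} (hz : z ∈ Metric.ball (0 : ℂ) (1 / 2)) (h0 : z ≠ 0) :
    z * (Real.pi / Complex.sin (Real.pi * z))
      = ∑ k ∈ Finset.range (K + 1), 2 * altZetaEven k * z ^ (2 * k)
        + z ^ (2 * K + 2) * cscTail K z := by
  induction K with
  | zero =>
    have hs : Complex.sin (Real.pi * z) ≠ 0 :=
      sin_pi_mul_ne_zero (mem_integerComplement_of_mem_ball hz h0)
    have h1 := mul_pi_mul_cot hz h0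
    have h2 := mul_pi_mul_cot (half_mem_ball hz) (div_ne_zero h0 two_ne_zero)
    rw [div_eq_mul_one_div, one_div_sin_eq_cot_sub_cot hs, mul_sub, mul_sub, h1,
      mul_div_assoc, show z * (Real.pi * Complex.cot (Real.pi * (z / 2)))
        = 2 * (z / 2 * (Real.pi * Complex.cot (Real.pi * (z / 2)))) by ring, h2]
    simp [cscTail, altZetaEven]
    ring
  | succ K ih =>
    rw [ih, Finset.sum_range_succ _ (K + 1), cscTail_eq K hz]
    ring

/-- The Laurent expansion of `π / sin (π z)` at an integer. -/
theorem eventually_pi_div_sin (K : ℕ) {a : ℂ} {ε : ℂ} (hε : ε * ε = 1)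
    (ha : ∀ w : ℂ, Complex.sin (Real.pi * (w + a)) = ε * Complex.sin (Real.pi * w)) :
    ∀ᶠ z in 𝓝[≠] a, Real.pi / Complex.sin (Real.pi * z)
      = ε * (z - a)⁻¹ * (∑ k ∈ Finset.range (K + 1), 2 * altZetaEven k * (z - a) ^ (2 * k)
        + (z - a) ^ (2 * K + 2) * cscTail K (z - a)) := by
  filter_upwards [self_mem_nhdsWithin,
    mem_nhdsWithin_of_mem_nhds (Metric.ball_mem_nhds a (by norm_num : (0 : ℝ) < 1 / 2))]
    with z hz hb
  have h0 : z - a ≠ 0 := sub_ne_zero.2 hz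
  have hb' : z - a ∈ Metric.ball (0 : ℂ) (1 / 2) := by simpa [dist_eq_norm] using hb
  have h1 := ha (z - a)
  rw [sub_add_cancel] at h1
  have hε0 : ε ≠ 0 := left_ne_zero_of_mul (hε ▸ one_ne_zero)
  have hs : Complex.sin (Real.pi * (z - a)) ≠ 0 :=
    sin_pi_mul_ne_zero (mem_integerComplement_of_mem_ball hb' h0)
  rw [h1, ← mul_pi_div_sin K hb' h0]
  field_simp
  linear_combination -hε

theorem neg_one_pow_mul_self (n : ℕ) : ((-1 : ℂ) ^ n) * (-1) ^ n = 1 := by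
  rw [← mul_pow]
  norm_num

theorem sin_pi_mul_add_natCast (n : ℕ) (w : ℂ) :
    Complex.sin (Real.pi * (w + n)) = (-1) ^ n * Complex.sin (Real.pi * w) := by
  rw [mul_add, mul_comm (Real.pi : ℂ) n]
  exact Complex.sin_antiperiodic.add_nat_mul_eq n

theorem sin_pi_mul_add_neg_natCast (n : ℕ) (w : ℂ) :
    Complex.sin (Real.pi * (w + -n)) = (-1) ^ n * Complex.sin (Real.pi * w) := by
  rw [← sub_eq_add_neg, mul_sub, mul_comm (Real.pi : ℂ) n]
  exact Complex.sin_antiperiodic.sub_nat_mul_eq n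

/-! ### Lower bound for |sin(πz)| on the circles. -/

theorem normSq_sin (z : ℂ) :
    Complex.normSq (Complex.sin z) = Real.sin z.re ^ 2 + Real.sinh z.im ^ 2 := by
  have h : Complex.sin z = ((Real.sin z.re * Real.cosh z.im : ℝ) : ℂ)
      + ((Real.cos z.re * Real.sinh z.im : ℝ) : ℂ) * Complex.I := by
    rw [Complex.sin_eq]
    push_cast
    rfl
  rw [h, Complex.normSq_add_mul_I, mul_pow, mul_pow, Real.cosh_sq, Real.cos_sq']
  ring

/-- If |Im z| ≥ 1/2, the sinh term is large. Otherwise |Re z| lies in [N + 1/4, N + 1/2], away from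
the integers, and Jordan's inequality applies. -/
theorem half_le_norm_sin {N : ℕ} (hN : 1 ≤ N) {z : ℂ} (hz : ‖z‖ = N + 1 / 2) :
    1 / 2 ≤ ‖Complex.sin (Real.pi * z)‖ := by
  have hN' : (1 : ℝ) ≤ N := by exact_mod_cast hN
  suffices h : 1 / 4 ≤ Complex.normSq (Complex.sin (Real.pi * z)) by
    rw [Complex.normSq_eq_norm_sq] at h
    nlinarith [norm_nonneg (Complex.sin (Real.pi * z))]
  have hre : (Real.pi * z : ℂ).re = Real.pi * z.re := by simp
  have him : (Real.pi * z : ℂ).im = Real.pi * z.im := by simp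
  rw [normSq_sin, hre, him]
  have hpi := Real.pi_gt_three
  rcases le_or_gt (1 / 2) |z.im| with hy | hy
  · have h1 : |Real.pi * z.im| ≤ |Real.sinh (Real.pi * z.im)| := by
      rw [Real.abs_sinh]
      exact Real.self_le_sinh_iff.2 (abs_nonneg _)
    have h2 : 1 ≤ |Real.pi * z.im| := by
      rw [abs_mul, abs_of_pos Real.pi_pos]
      nlinarith
    have h3 := sq_abs (Real.sinh (Real.pi * z.im))
    nlinarith [sq_nonneg (Real.sin (Real.pi * z.re))]
  · have h1 : |z.re| ^ 2 + |z.im| ^ 2 = ((N : ℝ) + 1 / 2) ^ 2 := by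
      rw [sq_abs, sq_abs, ← hz, Complex.sq_norm, Complex.normSq_apply]
      ring
    have hx0 := abs_nonneg z.re
    have hy0 := abs_nonneg z.im
    have hx1 : |z.re| ≤ N + 1 / 2 := by nlinarith
    -- Here |Re z|² > N² + N ≥ (N + 1/4)², which needs N ≥ 1.
    have hx2 : (N : ℝ) + 1 / 4 ≤ |z.re| := by nlinarith
    set t := |z.re| - N with ht
    have h2 : Real.sin (Real.pi * z.re) ^ 2 = Real.sin (Real.pi * t) ^ 2 := by
      have e1 : Real.sin (Real.pi * z.re) ^ 2 = Real.sin (Real.pi * |z.re|) ^ 2 := by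
        rcases abs_choice z.re with h | h <;> rw [h]
        rw [mul_neg, Real.sin_neg, neg_sq]
      rw [e1, ht, mul_sub, mul_comm Real.pi (N : ℝ), Real.sin_sub_nat_mul_pi, mul_pow, ← pow_mul,
        mul_comm N 2, pow_mul]
      norm_num
    have h3 : 1 / 2 ≤ Real.sin (Real.pi * t) := by
      have h4 := Real.mul_le_sin (x := Real.pi * t) (by
        refine mul_nonneg Real.pi_pos.le ?_
        linarith) (by nlinarith)
      refine le_trans ?_ h4
      rw [← mul_assoc, div_mul_cancel₀ _ Real.pi_ne_zero]
      linarith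
    rw [h2]
    nlinarith [sq_nonneg (Real.sinh (Real.pi * z.im))]

/-! ### Decay of r and its derivatives, and convergence of the series. -/

theorem mem_poles {r : RatFunc ℂ} {z : ℂ} : z ∈ poles r ↔ r.denom.eval z = 0 := by
  rw [poles, Multiset.mem_toFinset, Polynomial.mem_roots r.denom_ne_zero, Polynomial.IsRoot.def]

theorem ratValue_eq (r : RatFunc ℂ) : ratValue r = fun z => r.num.eval z / r.denom.eval z := rfl

theorem analyticAt_eval (q : Polynomial ℂ) (z : ℂ) : AnalyticAt ℂ (fun z => q.eval z) z :=
  AnalyticAt.aeval_polynomial analyticAt_id q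

theorem analyticAt_ratValue {r : RatFunc ℂ} {z : ℂ} (hz : z ∉ poles r) :
    AnalyticAt ℂ (ratValue r) z := by
  rw [ratValue_eq]
  exact (analyticAt_eval _ z).fun_div (analyticAt_eval _ z) fun h => hz (mem_poles.2 h)

theorem meromorphicAt_ratValue (r : RatFunc ℂ) (z : ℂ) : MeromorphicAt (ratValue r) z := by
  rw [ratValue_eq]
  exact (analyticAt_eval _ z).meromorphicAt.fun_div (analyticAt_eval _ z).meromorphicAt

theorem exists_norm_ratValue_le {r : RatFunc ℂ}
    (hr : (fun z : ℂ => ratValue r z) =O[Bornology.cobounded ℂ] (fun z : ℂ => (z ^ 2)⁻¹)) :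
    ∃ C ≥ 0, ∃ M ≥ 2, ∀ z, M ≤ ‖z‖ → z ∉ poles r ∧ ‖ratValue r z‖ ≤ C / ‖z‖ ^ 2 := by
  obtain ⟨C, hC, h⟩ := hr.exists_nonneg
  have h1 := h.bound
  rw [← comap_norm_atTop, eventually_comap] at h1
  obtain ⟨M₁, hM₁⟩ := eventually_atTop.1 h1
  obtain ⟨M₂, hM₂⟩ := (poles r).finite_toSet.isBounded.exists_norm_le
  refine ⟨C, hC, max (max M₁ (M₂ + 1)) 2, le_max_right _ _, fun z hz => ⟨fun hzp => ?_, ?_⟩⟩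
  · have h2 := hM₂ z hzp
    have h3 := (le_max_right M₁ (M₂ + 1)).trans ((le_max_left _ 2).trans hz)
    linarith
  · have := hM₁ ‖z‖ ((le_max_left _ _).trans ((le_max_left _ _).trans hz)) z rfl
    rwa [norm_inv, norm_pow, ← div_eq_mul_inv] at this

/-- Cauchy's estimate on the unit circle about z. There ‖w‖ ≥ M ≥ 2, so ‖z‖ ≤ 2‖w‖, whence the
factor 4. -/
theorem exists_norm_iteratedDeriv_ratValue_le {r : RatFunc ℂ}
    (hr : (fun z : ℂ => ratValue r z) =O[Bornology.cobounded ℂ] (fun z : ℂ => (z ^ 2)⁻¹))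
    (j : ℕ) :
    ∃ C ≥ 0, ∃ M, ∀ z, M ≤ ‖z‖ → ‖iteratedDeriv j (ratValue r) z‖ ≤ C / ‖z‖ ^ 2 := by
  obtain ⟨C, hC, M, hM2, hM⟩ := exists_norm_ratValue_le hr
  refine ⟨j.factorial * (4 * C), by positivity, M + 1, fun z hz => ?_⟩
  have hball : ∀ w ∈ Metric.closedBall z 1, ‖z‖ ≤ ‖w‖ + 1 := by
    intro w hw
    have h1 := norm_sub_norm_le z w
    have h2 : ‖z - w‖ ≤ 1 := by rwa [← dist_eq_norm, dist_comm]
    linarith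
  have h1 := Complex.norm_iteratedDeriv_le_of_forall_mem_sphere_norm_le (F := ℂ)
    (C := 4 * C / ‖z‖ ^ 2) (f := ratValue r) (c := z) j one_pos
    (diffContOnCl_ball_of_analyticAt fun w hw =>
      analyticAt_ratValue (hM w (by linarith [hball w hw])).1) (fun w hw => by
      have h2 := hball w (Metric.sphere_subset_closedBall hw)
      refine (hM w (by linarith)).2.trans ?_
      have h3 : 0 < ‖w‖ := by linarith
      have h4 : ‖z‖ ≤ 2 * ‖w‖ := by linarith
      rw [div_le_div_iff₀ (by positivity) (pow_pos (by linarith) 2)]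
      calc C * ‖z‖ ^ 2 ≤ C * (2 * ‖w‖) ^ 2 := by gcongr
        _ = _ := by ring)
  rwa [one_pow, div_one, ← mul_div_assoc] at h1

theorem exists_eventually_norm_iteratedDeriv_ratValue_le {r : RatFunc ℂ}
    (hr : (fun z : ℂ => ratValue r z) =O[Bornology.cobounded ℂ] (fun z : ℂ => (z ^ 2)⁻¹))
    (j : ℕ) {a : ℕ → ℂ} (ha : ∀ n : ℕ, (n : ℝ) ≤ ‖a n‖) :
    ∃ C, ∀ᶠ n : ℕ in atTop, ‖iteratedDeriv j (ratValue r) (a n)‖ ≤ C / ((n : ℝ) + 1) ^ 2 := by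
  obtain ⟨C, hC, M, hM⟩ := exists_norm_iteratedDeriv_ratValue_le hr j
  refine ⟨4 * C, ?_⟩
  filter_upwards [eventually_ge_atTop (max 1 ⌈M⌉₊)] with n hn
  have h1 : (1 : ℝ) ≤ n := by exact_mod_cast (le_max_left _ _).trans hn
  have h2 : M ≤ n := (Nat.le_ceil M).trans (by exact_mod_cast (le_max_right _ _).trans hn)
  have h3 := ha n
  refine (hM (a n) (h2.trans h3)).trans ?_
  rw [div_le_div_iff₀ (pow_pos (by linarith) 2) (by positivity)]
  calc C * ((n : ℝ) + 1) ^ 2 ≤ C * (2 * ‖a n‖) ^ 2 := by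
        gcongr
        linarith
    _ = _ := by ring

theorem summable_mul_of_norm_le {u f : ℕ → ℂ} {A C : ℝ} (hu : ∀ n : ℕ, ‖u n‖ ≤ A * √((n : ℝ) + 1))
    (hf : ∀ᶠ n : ℕ in atTop, ‖f n‖ ≤ C / ((n : ℝ) + 1) ^ 2) :
    Summable fun n => u n * f n := by
  have hs : Summable fun k : ℕ => A * C * (1 / (((k : ℝ) + 1) * √((k : ℝ) + 1))) := by
    have h := (Real.summable_one_div_nat_add_rpow 1 (3 / 2)).2 (by norm_num)
    refine Summable.mul_left _ (h.congr fun k => ?_)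
    have : (0 : ℝ) < (k : ℝ) + 1 := by positivity
    rw [abs_of_pos this, rpow_three_halves this]
  refine .of_norm_bounded_eventually_nat hs ?_
  filter_upwards [hf] with n hn
  have h0 : (0 : ℝ) < (n : ℝ) + 1 := by positivity
  have h1 : 0 < √((n : ℝ) + 1) := Real.sqrt_pos.2 h0
  have h2 := Real.mul_self_sqrt h0.le
  rw [norm_mul]
  calc ‖u n‖ * ‖f n‖ ≤ (A * √((n : ℝ) + 1)) * (C / ((n : ℝ) + 1) ^ 2) :=
        mul_le_mul (hu n) hn (norm_nonneg _) ((norm_nonneg _).trans (hu n))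
    _ = A * C * (1 / (((n : ℝ) + 1) * √((n : ℝ) + 1))) := by
        field_simp
        rw [pow_two, h2]

/-- Each increment is at most 1/(n+1) ≤ 2(√(n+1) - √n), which telescopes. This crude bound is
enough, as n^(1/2) · n⁻² is summable. -/
theorem norm_harmonicNumber_le {p : ℕ} (hp : 1 ≤ p) (n : ℕ) :
    ‖harmonicNumber p n‖ ≤ 2 * √(n : ℝ) := by
  induction n with
  | zero => simp [harmonicNumber]
  | succ n ih =>
    rw [harmonicNumber_eq_sum_range, Finset.sum_range_succ, ← harmonicNumber_eq_sum_range]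
    have h2 : ‖((n : ℂ) + 1)‖ = (n : ℝ) + 1 := by exact_mod_cast Complex.norm_natCast (n + 1)
    have h0 : (0 : ℝ) ≤ n := n.cast_nonneg
    have h3 : ‖1 / ((n : ℂ) + 1) ^ p‖ ≤ 1 / ((n : ℝ) + 1) := by
      rw [norm_div, norm_one, norm_pow, h2]
      gcongr
      exact le_self_pow₀ (by linarith) (by omega)
    have h4 : 1 / ((n : ℝ) + 1) ≤ 2 * (√((n : ℝ) + 1) - √(n : ℝ)) := by
      have e1 := Real.sq_sqrt h0
      have e2 := Real.sq_sqrt (by linarith : (0 : ℝ) ≤ (n : ℝ) + 1)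
      have e3 := Real.sqrt_nonneg (n : ℝ)
      have e4 : √(n : ℝ) ≤ √((n : ℝ) + 1) := Real.sqrt_le_sqrt (by linarith)
      have e5 : 1 ≤ √((n : ℝ) + 1) := Real.one_le_sqrt.2 (by linarith)
      set a := √(n : ℝ)
      set b := √((n : ℝ) + 1)
      rw [div_le_iff₀ (by linarith), ← e2]
      have e6 : (b - a) * (b + a) = 1 := by linarith [mul_self_nonneg a, e1, e2, sq_sub_sq b a]
      have e7 : 1 ≤ 2 * (b - a) * b := by nlinarith
      nlinarith
    push_cast
    linarith [norm_add_le (harmonicNumber p n) (1 / ((n : ℂ) + 1) ^ p)]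

theorem norm_const_add_harmonicNumber_le {p : ℕ} (hp : 1 ≤ p) (c : ℂ) (n : ℕ) :
    ‖c‖ + ‖harmonicNumber p n‖ ≤ (‖c‖ + 2) * √((n : ℝ) + 1) := by
  have h0 : (0 : ℝ) ≤ n := n.cast_nonneg
  have h1 := norm_harmonicNumber_le hp n
  have e4 : √(n : ℝ) ≤ √((n : ℝ) + 1) := Real.sqrt_le_sqrt (by linarith)
  have e5 : 1 ≤ √((n : ℝ) + 1) := Real.one_le_sqrt.2 (by linarith)
  have := mul_le_mul_of_nonneg_left e5 (norm_nonneg c)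
  linarith

theorem norm_neg_one_pow (n : ℕ) : ‖(-1 : ℂ) ^ n‖ = 1 := by simp

theorem summable_nonneg_integers {p : ℕ} (hp : 1 ≤ p) {r : RatFunc ℂ}
    (hr : (fun z : ℂ => ratValue r z) =O[Bornology.cobounded ℂ] (fun z : ℂ => (z ^ 2)⁻¹)) :
    Summable (fun n : ℕ => ((-1 : ℂ) ^ p * zetaValue p + harmonicNumber p n) *
      (-1 : ℂ) ^ n * ratValue r (n : ℂ)) := by
  obtain ⟨C, h⟩ := exists_eventually_norm_iteratedDeriv_ratValue_le hr 0
    (a := fun n : ℕ => (n : ℂ)) (fun n => by simp)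
  refine summable_mul_of_norm_le (A := ‖(-1 : ℂ) ^ p * zetaValue p‖ + 2) (fun n => ?_)
    (by simpa only [iteratedDeriv_zero] using h)
  rw [norm_mul, norm_neg_one_pow, mul_one]
  exact (norm_add_le _ _).trans (norm_const_add_harmonicNumber_le hp _ n)

theorem summable_neg_integers {p : ℕ} (hp : 1 ≤ p) {r : RatFunc ℂ}
    (hr : (fun z : ℂ => ratValue r z) =O[Bornology.cobounded ℂ] (fun z : ℂ => (z ^ 2)⁻¹)) :
    Summable (fun n : ℕ => (zetaValue p - harmonicNumber p n) *
      (-1 : ℂ) ^ (n + 1) * ratValue r (-((n : ℂ) + 1))) := by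
  obtain ⟨C, h⟩ := exists_eventually_norm_iteratedDeriv_ratValue_le hr 0
    (a := fun n : ℕ => -((n : ℂ) + 1)) (fun n => by
      have h2 : ‖((n : ℂ) + 1)‖ = (n : ℝ) + 1 := by exact_mod_cast Complex.norm_natCast (n + 1)
      rw [norm_neg, h2]
      linarith)
  refine summable_mul_of_norm_le (A := ‖zetaValue p‖ + 2) (fun n => ?_)
    (by simpa only [iteratedDeriv_zero] using h)
  rw [norm_mul, norm_neg_one_pow, mul_one]
  exact (norm_sub_le _ _).trans (norm_const_add_harmonicNumber_le hp _ n)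

theorem summable_iteratedDeriv (j : ℕ) {r : RatFunc ℂ}
    (hr : (fun z : ℂ => ratValue r z) =O[Bornology.cobounded ℂ] (fun z : ℂ => (z ^ 2)⁻¹)) :
    Summable (fun n : ℕ => (-1 : ℂ) ^ n * iteratedDeriv j (ratValue r) (n : ℂ)) := by
  obtain ⟨C, h⟩ := exists_eventually_norm_iteratedDeriv_ratValue_le hr j
    (a := fun n : ℕ => (n : ℂ)) (fun n => by simp)
  refine summable_mul_of_norm_le (A := 1) (fun n => ?_) h
  rw [norm_neg_one_pow, one_mul]
  have h0 : (0 : ℝ) ≤ n := n.cast_nonneg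
  exact Real.one_le_sqrt.2 (by linarith)

/-! ### Residues of the kernel at the integers. -/

theorem kernelMul_eq (p : ℕ) (r : RatFunc ℂ) (z : ℂ) :
    kernelMul p r z
      = polygammaFactor p z * (Real.pi / Complex.sin (Real.pi * z)) * ratValue r z := by
  rw [kernelMul, polygammaFactor]
  ring

theorem meromorphicAt_polygammaFactor {p : ℕ} (hp : 1 ≤ p) (z : ℂ) :
    MeromorphicAt (polygammaFactor p) z := by
  by_cases hz : -z ∈ gammaDomain
  · exact (analyticAt_polygammaFactor p hz).meromorphicAt
  · rw [neg_mem_gammaDomain] at hz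
    push Not at hz
    obtain ⟨n, rfl⟩ := hz
    obtain ⟨B, hB, -, h⟩ := exists_polygammaFactor_eq hp n
    have h1 : MeromorphicAt (fun z : ℂ => ((z - n) ^ p)⁻¹ + B z) n :=
      (by fun_prop : MeromorphicAt (fun z : ℂ => (z - n) ^ p) n).fun_inv.fun_add hB.meromorphicAt
    exact h1.congr (h.mono fun z hz => hz.symm)

theorem analyticAt_sin_pi_mul (z : ℂ) :
    AnalyticAt ℂ (fun z : ℂ => Complex.sin (Real.pi * z)) z := by
  have h : Differentiable ℂ (fun z : ℂ => Complex.sin (Real.pi * z)) := by fun_prop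
  exact h.analyticAt z

theorem meromorphicAt_kernelMul {p : ℕ} (hp : 1 ≤ p) (r : RatFunc ℂ) (z : ℂ) :
    MeromorphicAt (kernelMul p r) z := by
  rw [funext (kernelMul_eq p r)]
  exact ((meromorphicAt_polygammaFactor hp z).fun_mul
    ((MeromorphicAt.const _ z).fun_div (analyticAt_sin_pi_mul z).meromorphicAt)).fun_mul
    (meromorphicAt_ratValue r z)

theorem analyticAt_kernelMul (p : ℕ) {r : RatFunc ℂ} {z : ℂ} (hz : ∀ m : ℤ, z ≠ m)
    (hzr : z ∉ poles r) : AnalyticAt ℂ (kernelMul p r) z := by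
  rw [funext (kernelMul_eq p r)]
  refine ((analyticAt_polygammaFactor p ?_).fun_mul
    (analyticAt_const.fun_div (analyticAt_sin_pi_mul z) ?_)).fun_mul (analyticAt_ratValue hzr)
  · exact neg_mem_gammaDomain.2 fun m => by exact_mod_cast hz m
  · exact sin_pi_mul_ne_zero (Complex.mem_integerComplement_iff.2 fun ⟨n, hn⟩ => hz n hn.symm)

theorem analyticAt_cscExpansion (K : ℕ) (a : ℂ) :
    AnalyticAt ℂ (fun z => ∑ k ∈ Finset.range (K + 1), 2 * altZetaEven k * (z - a) ^ (2 * k)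
        + (z - a) ^ (2 * K + 2) * cscTail K (z - a)) a := by
  have h1 : AnalyticAt ℂ (fun z => cscTail K (z - a)) a :=
    AnalyticAt.fun_comp (f := fun z => z - a) (by simpa using analyticAt_cscTail K) (by fun_prop)
  refine (Finset.analyticAt_fun_sum _ fun k _ => ?_).fun_add ?_
  · fun_prop
  · exact AnalyticAt.fun_mul (by fun_prop) h1

theorem cscExpansion_self (K : ℕ) (a : ℂ) :
    ∑ k ∈ Finset.range (K + 1), 2 * altZetaEven k * (a - a) ^ (2 * k)
        + (a - a) ^ (2 * K + 2) * cscTail K (a - a) = 1 := by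
  rw [Finset.sum_range_succ', Finset.sum_eq_zero fun k _ => by simp]
  simp [altZetaEven]

/-- Only 1/sin is singular at a, with a simple pole. The sign ε is its own inverse, so dividing by
it is multiplying by it. -/
theorem hasResidue_kernelMul_of_sin {p : ℕ} {r : RatFunc ℂ} {a ε : ℂ} (hε : ε * ε = 1)
    (ha : ∀ w : ℂ, Complex.sin (Real.pi * (w + a)) = ε * Complex.sin (Real.pi * w))
    (hag : -a ∈ gammaDomain) (har : a ∉ poles r) :
    HasResidue (kernelMul p r) a (polygammaFactor p a * ε * ratValue r a) := by
  have hG : AnalyticAt ℂ (fun z => polygammaFactor p z * ε * ratValue r z *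
      (∑ k ∈ Finset.range (0 + 1), 2 * altZetaEven k * (z - a) ^ (2 * k)
        + (z - a) ^ (2 * 0 + 2) * cscTail 0 (z - a))) a :=
    (((analyticAt_polygammaFactor p hag).fun_mul analyticAt_const).fun_mul
      (analyticAt_ratValue har)).fun_mul (analyticAt_cscExpansion 0 a)
  have h := hasResidue_mul_inv_pow hG 0
  simp only [iteratedDeriv_zero, cscExpansion_self, Nat.factorial_zero, Nat.cast_one, div_one,
    one_mul, mul_one] at h
  refine h.congr ?_
  filter_upwards [eventually_pi_div_sin 0 hε ha] with z hz
  rw [kernelMul_eq, hz]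
  ring

theorem hasResidue_kernelMul_natCast {p : ℕ} (hp : 1 ≤ p) {r : RatFunc ℂ} (n : ℕ)
    (hn : (n : ℂ) ∉ poles r) :
    HasResidue (kernelMul p r) n
      (((-1 : ℂ) ^ p * zetaValue p + harmonicNumber p n) * (-1 : ℂ) ^ n * ratValue r n
      + ∑ k ∈ Finset.range (p / 2 + 1), 2 * (1 / ((p - 2 * k).factorial : ℂ) * altZetaEven k *
          ((-1 : ℂ) ^ n * iteratedDeriv (p - 2 * k) (ratValue r) n))) := by
  obtain ⟨B, hB, hBn, hΨ⟩ := exists_polygammaFactor_eq hp n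
  -- Truncating the cosecant at K = ⌊p/2⌋ keeps every term that meets (z-n)^(-p) in a pole.
  set K := p / 2 with hK
  have hr := analyticAt_ratValue hn
  have hG : AnalyticAt ℂ (fun z => B z * (-1 : ℂ) ^ n * ratValue r z *
      (∑ k ∈ Finset.range (K + 1), 2 * altZetaEven k * (z - n) ^ (2 * k)
        + (z - n) ^ (2 * K + 2) * cscTail K (z - n))) n :=
    ((hB.fun_mul analyticAt_const).fun_mul hr).fun_mul (analyticAt_cscExpansion K n)
  have h1 := hasResidue_mul_inv_pow hG 0
  simp only [iteratedDeriv_zero, cscExpansion_self, Nat.factorial_zero, Nat.cast_one, div_one,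
    one_mul, mul_one, hBn] at h1
  have h2 := HasResidue.sum (Finset.range (K + 1)) fun k _ =>
    (hasResidue_mul_inv_pow hr (p - 2 * k)).const_mul (2 * (-1 : ℂ) ^ n * altZetaEven k)
  -- The tail has order 2K + 2 against a pole of order p + 1; as p ≤ 2K + 1, the natural subtraction
  -- is exact and the product is analytic.
  have hJ : AnalyticAt ℂ (fun z => (-1 : ℂ) ^ n * (z - n) ^ (2 * K + 1 - p) *
      cscTail K (z - n) * ratValue r z) n := by
    have h3 : AnalyticAt ℂ (fun z => cscTail K (z - n)) n :=
      AnalyticAt.fun_comp (f := fun z => z - (n : ℂ)) (by simpa using analyticAt_cscTail K)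
        (by fun_prop)
    exact (AnalyticAt.fun_mul (by fun_prop) h3).fun_mul hr
  have h := (h1.add h2).add (hasResidue_zero_of_analyticAt hJ)
  rw [add_zero] at h
  have hval : ∑ k ∈ Finset.range (K + 1), 2 * (-1 : ℂ) ^ n * altZetaEven k *
        (1 / ((p - 2 * k).factorial : ℂ) * iteratedDeriv (p - 2 * k) (ratValue r) n)
      = ∑ k ∈ Finset.range (K + 1), 2 * (1 / ((p - 2 * k).factorial : ℂ) * altZetaEven k *
          ((-1 : ℂ) ^ n * iteratedDeriv (p - 2 * k) (ratValue r) n)) :=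
    Finset.sum_congr rfl fun k _ => by ring
  rw [hval] at h
  refine h.congr ?_
  filter_upwards [hΨ, self_mem_nhdsWithin, eventually_pi_div_sin K (neg_one_pow_mul_self n)
    (sin_pi_mul_add_natCast n)] with z hz1 hz2 hz3
  have hw : z - n ≠ 0 := sub_ne_zero.2 hz2
  rw [kernelMul_eq, hz1, hz3]
  set w := z - (n : ℂ)
  have e1 : ∀ k ∈ Finset.range (K + 1), 2 * (-1 : ℂ) ^ n * altZetaEven k *
        (ratValue r z * (w ^ (p - 2 * k + 1))⁻¹)
      = (-1 : ℂ) ^ n * ratValue r z * (w ^ p)⁻¹ * w⁻¹ * (2 * altZetaEven k * w ^ (2 * k)) := by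
    intro k hk
    have hk' : 2 * k ≤ p := by
      have := Finset.mem_range.1 hk
      omega
    obtain ⟨d, rfl⟩ := Nat.exists_eq_add_of_le hk'
    rw [Nat.add_sub_cancel_left, pow_add w (2 * k)]
    field_simp
    ring
  have e2 : w ^ (2 * K + 1 - p) = w ^ (2 * K + 2) * ((w ^ p)⁻¹ * w⁻¹) := by
    obtain ⟨d, hd⟩ := Nat.exists_eq_add_of_le (by omega : p ≤ 2 * K + 1)
    rw [show 2 * K + 2 = p + d + 1 by omega, hd, Nat.add_sub_cancel_left]
    field_simp
    ring
  rw [Finset.sum_congr rfl e1, ← Finset.mul_sum, e2]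
  ring

/-! ### Contour integrals over growing circles. -/

theorem exists_norm_circleIntegral_kernelMul_le {p : ℕ} (hp : 1 ≤ p) {r : RatFunc ℂ}
    (hr : (fun z : ℂ => ratValue r z) =O[Bornology.cobounded ℂ] (fun z : ℂ => (z ^ 2)⁻¹)) :
    ∃ D : ℝ, ∀ᶠ N : ℕ in atTop,
      ‖(2 * Real.pi * Complex.I : ℂ)⁻¹ * ∮ z in C(0, (N : ℝ) + 1 / 2), kernelMul p r z‖
        ≤ D / √((N : ℝ) + 1 / 2) := by
  obtain ⟨C, hC, M, -, hM⟩ := exists_norm_ratValue_le hr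
  obtain ⟨A, hA⟩ := exists_norm_polygammaFactor_le hp
  refine ⟨2 * Real.pi * A * C, ?_⟩
  filter_upwards [eventually_ge_atTop (max 1 ⌈M⌉₊)] with N hN
  have hN1 : 1 ≤ N := (le_max_left _ _).trans hN
  have h1 : (1 : ℝ) ≤ N := by exact_mod_cast hN1
  have h2 : M ≤ N := (Nat.le_ceil M).trans (by exact_mod_cast (le_max_right _ _).trans hN)
  set R := (N : ℝ) + 1 / 2 with hR
  have hR0 : 0 < R := by linarith
  have hsR : 0 < √R := Real.sqrt_pos.2 hR0
  have hb : ∀ z ∈ Metric.sphere (0 : ℂ) R,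
      ‖kernelMul p r z‖ ≤ A * √R * (2 * Real.pi) * (C / R ^ 2) := by
    intro z hz
    have hz' : ‖z‖ = R := by simpa using hz
    have hs := half_le_norm_sin hN1 hz'
    rw [kernelMul_eq, norm_mul, norm_mul]
    have h3 : ‖(Real.pi : ℂ) / Complex.sin (Real.pi * z)‖ ≤ 2 * Real.pi := by
      rw [norm_div, Complex.norm_of_nonneg Real.pi_pos.le, div_le_iff₀ (by linarith)]
      nlinarith [Real.pi_pos]
    have h4 := (hM z (by rw [hz']; linarith)).2
    rw [hz'] at h4
    have h5 := hA N z hz'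
    have h6 : 0 ≤ A * √R := (norm_nonneg _).trans h5
    have := Real.pi_pos
    gcongr
  have h := circleIntegral.norm_two_pi_i_inv_smul_integral_le_of_norm_le_const hR0.le hb
  rw [smul_eq_mul] at h
  refine h.trans (le_of_eq ?_)
  have h3 := Real.mul_self_sqrt hR0.le
  field_simp
  rw [pow_two, h3]
  ring

theorem tendsto_circleIntegral_kernelMul {p : ℕ} (hp : 1 ≤ p) {r : RatFunc ℂ}
    (hr : (fun z : ℂ => ratValue r z) =O[Bornology.cobounded ℂ] (fun z : ℂ => (z ^ 2)⁻¹)) :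
    Tendsto (fun N : ℕ =>
      (2 * Real.pi * Complex.I : ℂ)⁻¹ * ∮ z in C(0, (N : ℝ) + 1 / 2), kernelMul p r z)
      atTop (𝓝 0) := by
  obtain ⟨D, hD⟩ := exists_norm_circleIntegral_kernelMul_le hp hr
  refine squeeze_zero_norm' hD ?_
  exact (Real.tendsto_sqrt_atTop.comp
    (tendsto_atTop_add_const_right _ _ tendsto_natCast_atTop_atTop)).const_div_atTop D

/-- The disc holds the N + 1 integers 0, …, N and the N integers -1, …, -N, and all poles of r once
N is large; these three sets are disjoint. -/
theorem eventually_circleIntegral_kernelMul {p : ℕ} (hp : 1 ≤ p) {r : RatFunc ℂ}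
    (hint : ∀ m : ℤ, (m : ℂ) ∉ poles r) :
    ∀ᶠ N : ℕ in atTop,
      (2 * Real.pi * Complex.I : ℂ)⁻¹ * (∮ z in C(0, (N : ℝ) + 1 / 2), kernelMul p r z)
        = ∑ n ∈ Finset.range (N + 1), residue (kernelMul p r) n
          + ∑ n ∈ Finset.range N, residue (kernelMul p r) (-((n : ℂ) + 1))
          + ∑ β ∈ poles r, residue (kernelMul p r) β := by
  classical
  obtain ⟨M, hM⟩ := (poles r).finite_toSet.isBounded.exists_norm_le
  filter_upwards [eventually_ge_atTop ⌈M⌉₊] with N hN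
  have hMN : M ≤ N := (Nat.le_ceil M).trans (by exact_mod_cast hN)
  set A := (Finset.range (N + 1)).image fun n : ℕ => (n : ℂ) with hA
  set B := (Finset.range N).image fun n : ℕ => -((n : ℂ) + 1) with hB
  have hAint : ∀ z ∈ A, ∃ m : ℕ, m ≤ N ∧ z = m := by
    intro z hz
    obtain ⟨m, hm, rfl⟩ := Finset.mem_image.1 hz
    exact ⟨m, Nat.lt_succ_iff.1 (Finset.mem_range.1 hm), rfl⟩
  have hBint : ∀ z ∈ B, ∃ m : ℕ, m + 1 ≤ N ∧ z = -((m : ℂ) + 1) := by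
    intro z hz
    obtain ⟨m, hm, rfl⟩ := Finset.mem_image.1 hz
    exact ⟨m, Finset.mem_range.1 hm, rfl⟩
  have hAB : Disjoint A B := by
    rw [Finset.disjoint_left]
    intro z hzA hzB
    obtain ⟨m, -, rfl⟩ := hAint z hzA
    obtain ⟨k, -, hk⟩ := hBint _ hzB
    have : ((m + (k + 1) : ℕ) : ℂ) = 0 := by
      push_cast
      rw [hk]
      ring
    have h0 : m + (k + 1) = 0 := by exact_mod_cast this
    omega
  have hABT : Disjoint (A ∪ B) (poles r) := by
    rw [Finset.disjoint_left]
    intro z hz hzT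
    rcases Finset.mem_union.1 hz with h | h
    · obtain ⟨m, -, rfl⟩ := hAint z h
      exact hint m (by exact_mod_cast hzT)
    · obtain ⟨m, -, rfl⟩ := hBint z h
      exact hint (-((m : ℤ) + 1)) (by exact_mod_cast hzT)
  have hres := circleIntegral_eq_sum_residue (c := 0) (R := (N : ℝ) + 1 / 2)
    (A ∪ B ∪ poles r) (kernelMul p r) (by positivity) (fun s hs => by
      refine ⟨?_, meromorphicAt_kernelMul hp r s⟩
      rw [Metric.mem_ball, dist_zero_right]
      rcases Finset.mem_union.1 hs with hs | hs
      · rcases Finset.mem_union.1 hs with h | h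
        · obtain ⟨m, hm, rfl⟩ := hAint s h
          have : (m : ℝ) ≤ N := by exact_mod_cast hm
          rw [Complex.norm_natCast]
          linarith
        · obtain ⟨m, hm, rfl⟩ := hBint s h
          have : (m : ℝ) + 1 ≤ N := by exact_mod_cast hm
          have h2 : ‖((m : ℂ) + 1)‖ = (m : ℝ) + 1 := by
            exact_mod_cast Complex.norm_natCast (m + 1)
          rw [norm_neg, h2]
          linarith
      · have := hM s hs
        linarith) (fun z hz hzS => by
      refine analyticAt_kernelMul p (fun m hm => hzS ?_)
        (fun h => hzS (Finset.mem_union_right _ h))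
      refine Finset.mem_union_left _ ?_
      rw [Metric.mem_closedBall, dist_zero_right, hm, Complex.norm_intCast] at hz
      have hlt : |(m : ℝ)| < (N : ℝ) + 1 := by linarith
      have hlt' : |m| < (N : ℤ) + 1 := by exact_mod_cast hlt
      rw [abs_lt] at hlt'
      rcases le_or_gt 0 m with h0 | h0
      · refine Finset.mem_union_left _ (Finset.mem_image.2 ⟨m.toNat, ?_, ?_⟩)
        · rw [Finset.mem_range]
          omega
        · rw [hm]
          exact_mod_cast Int.toNat_of_nonneg h0
      · refine Finset.mem_union_right _ (Finset.mem_image.2 ⟨(-m - 1).toNat, ?_, ?_⟩)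
        · rw [Finset.mem_range]
          omega
        · have h1 : (((-m - 1).toNat : ℤ) : ℂ) = ((-m - 1 : ℤ) : ℂ) := by
            rw [Int.toNat_of_nonneg (by omega)]
          rw [hm, ← Int.cast_natCast, h1]
          push_cast
          ring)
  rw [hres, Finset.sum_union hABT, Finset.sum_union hAB,
    Finset.sum_image (fun a _ b _ h => by exact_mod_cast h),
    Finset.sum_image (fun a _ b _ h => by
      have : (a : ℂ) = b := by linear_combination -h
      exact_mod_cast this)]
  exact inv_mul_cancel_left₀ Complex.two_pi_I_ne_zero _

end ParamEuler

/-! ### Conclusion. -/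

theorem mainTheorem3 (p : ℕ) (hp : 1 ≤ p) (r : RatFunc ℂ)
    (hr : (fun z : ℂ => ParamEuler.ratValue r z) =O[Bornology.cobounded ℂ]
      (fun z : ℂ => (z ^ 2)⁻¹))
    (hint : ∀ m : ℤ, (m : ℂ) ∉ ParamEuler.poles r) :
    Summable (fun n : ℕ => ((-1 : ℂ) ^ p * ParamEuler.zetaValue p + ParamEuler.harmonicNumber p n) *
      (-1 : ℂ) ^ n * ParamEuler.ratValue r (n : ℂ)) ∧
    Summable (fun n : ℕ => (ParamEuler.zetaValue p - ParamEuler.harmonicNumber p n) *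
      (-1 : ℂ) ^ (n + 1) * ParamEuler.ratValue r (-((n : ℂ) + 1))) ∧
    (∀ k ∈ Finset.range (p / 2 + 1), Summable (fun n : ℕ =>
      (-1 : ℂ) ^ n * iteratedDeriv (p - 2 * k) (ParamEuler.ratValue r) (n : ℂ))) ∧
    (∑' n : ℕ, ((-1 : ℂ) ^ p * ParamEuler.zetaValue p + ParamEuler.harmonicNumber p n) *
        (-1 : ℂ) ^ n * ParamEuler.ratValue r (n : ℂ))
      + (-1 : ℂ) ^ p * (∑' n : ℕ, (ParamEuler.zetaValue p - ParamEuler.harmonicNumber p n) *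
        (-1 : ℂ) ^ (n + 1) * ParamEuler.ratValue r (-((n : ℂ) + 1)))
      + 2 * (∑ k ∈ Finset.range (p / 2 + 1),
        1 / ((p - 2 * k).factorial : ℂ) * ParamEuler.altZetaEven k *
          ∑' n : ℕ, (-1 : ℂ) ^ n * iteratedDeriv (p - 2 * k) (ParamEuler.ratValue r) (n : ℂ))
      + (∑ β ∈ ParamEuler.poles r, ParamEuler.residue (ParamEuler.kernelMul p r) β) = 0 := by
  have s1 := ParamEuler.summable_nonneg_integers hp hr
  have s2 := ParamEuler.summable_neg_integers hp hr
  have s3 := fun j => ParamEuler.summable_iteratedDeriv j hr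
  refine ⟨s1, s2, fun k _ => s3 _, ?_⟩
  have hA : HasSum (fun n : ℕ => ParamEuler.residue (ParamEuler.kernelMul p r) n) _ :=
    (s1.hasSum.add (hasSum_sum fun k (_ : k ∈ Finset.range (p / 2 + 1)) =>
      (((s3 (p - 2 * k)).hasSum.mul_left (1 / ((p - 2 * k).factorial : ℂ) *
        ParamEuler.altZetaEven k)).mul_left 2))).congr_fun fun n =>
      (ParamEuler.hasResidue_kernelMul_natCast hp n (by exact_mod_cast hint n)).residue_eq
  have hB : HasSum (fun n : ℕ => ParamEuler.residue (ParamEuler.kernelMul p r) (-((n : ℂ) + 1))) _ :=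
    (s2.hasSum.mul_left ((-1 : ℂ) ^ p)).congr_fun fun n => by
      have h := ParamEuler.hasResidue_kernelMul_of_sin (p := p) (r := r) (a := -((n : ℂ) + 1))
        (ParamEuler.neg_one_pow_mul_self (n + 1))
        (by exact_mod_cast ParamEuler.sin_pi_mul_add_neg_natCast (n + 1))
        (ParamEuler.neg_mem_gammaDomain.2 fun m hm => by
          have h1 : ((m + (n + 1) : ℕ) : ℂ) = 0 := by
            push_cast
            rw [← hm]
            ring
          have h0 : m + (n + 1) = 0 := by exact_mod_cast h1
          omega)
        (by exact_mod_cast hint (-((n : ℤ) + 1)))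
      rw [h.residue_eq, ParamEuler.polygammaFactor_neg hp]
      ring
  -- The shift by one accounts for the N + 1 nonnegative integers against N negative ones in the
  -- disc.
  have hlim := ((hA.tendsto_sum_nat.comp (Filter.tendsto_add_atTop_nat 1)).add
    hB.tendsto_sum_nat).add_const (∑ β ∈ ParamEuler.poles r,
      ParamEuler.residue (ParamEuler.kernelMul p r) β)
  have hzero := (ParamEuler.tendsto_circleIntegral_kernelMul hp hr).congr'
    (ParamEuler.eventually_circleIntegral_kernelMul hp hint)
  rw [← tendsto_nhds_unique hlim hzero, Finset.mul_sum]
  ring
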